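/- Let $\mathbb F_q$ be a finite field and let $E$ be an elliptic curve over $\mathbb F_q$ whose number $N=|E(\mathbb F_q)|$ of rational points is even. For a divisor $G$ of the function field $K=\mathbb F_q(E)$ let $\mathscr L(G)=\{f\in K : f=0 \text{ or } (f)+G\ge 0\}$ be its Riemann–Roch space, and for distinct rational points $P_1,\dots,P_n$ outside the support of $G$, with $D=P_1+\dots+P_n$, let $C_{\mathscr L}(D,G)=\{(f(P_1),\dots,f(P_n)) : f\in\mathscr L(G)\}$. A linear code has parameters $[n,k,d]$ if it has length $n$, dimension $k$ and minimum Hamming distance $d$; it is MDS if $d=n-k+1$. For a rational point $R$ let $v_R$ be the normalized discrete valuation of $K$ at $R$. The group $E(\mathbb F_q)$ has a subgroup of index $2$. Let $H$ be any such subgroup; then $|H|=N/2$ and $E(\mathbb F_q)\setminus H\ne\emptyset$. (a) Even dimension. Let $k$ be even, $2\le k\le N/2$. Let $P\in H$ and $Q\in E(\mathbb F_q)\setminus H$ be arbitrary, put $G=P+(k-1)Q$, let $P_1,\dots,P_n$ be the $n=N/2-1$ points of $H\setminus\{P\}$, and let $D=P_1+\dots+P_n$. If $k<N/2$, then $C_{\mathscr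 L}(D,G)$ is an MDS code with parameters $[N/2-1,k,N/2-k]$. There are functions $f_2,\dots,f_{k-1},g\in\mathscr L(G)$ with $$v_Q(f_i)=-i,\quad v_P(f_i)=0\quad(2\le i\le k-1),\qquad v_P(g)=v_Q(g)=-1.$$ For every choice of such functions, $1,f_2,\dots,f_{k-1},g$ is a basis of $\mathscr L(G)$, and the code generated by the rows of $$\begin{pmatrix}1&\cdots&1&0\\ f_2(P_1)&\cdots&f_2(P_n)&0\\ \vdots&&\vdots&\vdots\\ f_{k-1}(P_1)&\cdots&f_{k-1}(P_n)&0\\ g(P_1)&\cdots&g(P_n)&1\end{pmatrix},$$ which arises from $C_{\mathscr L}(D,G)$ by appending a coordinate that is $0$ on $1,f_2,\dots,f_{k-1}$ and $1$ on $g$, is an MDS code with parameters $[N/2,\,k,\,N/2-k+1]$. (b) Odd dimension. Let $k$ be odd, $1\le k\le N/2$, let $Q\in E(\mathbb F_q)\setminus H$ be arbitrary, and let $D$ be the sum of all points of $H$. Then $C_{\mathscr L}(D,kQ)$ is an MDS code with parameters $[N/2,\,k,\,N/2-k+1]$. Consequently $E$ yields MDS codes of length $N/2$ in every dimension $1\le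 k\le N/2$. -/

import Mathlib

open scoped Polynomial.Bivariate

section FunctionFields

/-- A place of a field extension `K / F` (with `K` thought of as a function field over the constant
field `F`): a valuation ring `O` of `K` with `F ⊆ O ⊊ K`. -/
structure Place (F K : Type*) [Field F] [Field K] [Algebra F K] where
  ring : ValuationSubring K
  algebraMap_mem : ∀ c : F, algebraMap F K c ∈ ring
  ne_top : ring ≠ ⊤

namespace Place

variable {F K : Type*} [Field F] [Field K] [Algebra F K]

/-- The (multiplicatively written) valuation attached to a place: `v.val f ≤ 1` if and only if `f`
is regular at `v`, and `v.val f < 1` if and only if `f` vanishes at `v`. -/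
noncomputable def val (v : Place F K) : Valuation K v.ring.ValueGroup := v.ring.valuation

/-- A uniformizer at `v`: a generator of the maximal ideal of the valuation ring. -/
def IsUniformizer (v : Place F K) (t : K) : Prop :=
  v.val t < 1 ∧ ∀ s : K, v.val s < 1 → v.val s ≤ v.val t

/-- `v.HasOrd f n`: the normalized discrete valuation of `f` at `v` is the integer `n`, that is,
`f` is a unit of the valuation ring times the `n`-th power of a uniformizer. -/
def HasOrd (v : Place F K) (f : K) (n : ℤ) : Prop :=
  ∃ t : K, v.IsUniformizer t ∧ v.val f = v.val t ^ n

/-- `v.HasValue f c`: the function `f` is regular at `v`, with value `c ∈ F` there, that is, `f` and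
the constant `c` have the same image in the residue field of `v`. -/
def HasValue (v : Place F K) (f : K) (c : F) : Prop :=
  v.val (f - algebraMap F K c) < 1

open Classical in
/-- The value `f(v) ∈ F` of a function `f` at a place `v` (it is `0` by convention if `f` has no
value in `F` at `v`). -/
noncomputable def value (v : Place F K) (f : K) : F :=
  if h : ∃ c : F, v.HasValue f c then h.choose else 0

theorem val_algebraMap_le_one (v : Place F K) (c : F) : v.val (algebraMap F K c) ≤ 1 :=
  (v.ring.valuation_le_one_iff _).2 (v.algebraMap_mem c)

end Place

variable {F K : Type*} [Field F] [Field K] [Algebra F K]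

/-- The Riemann-Roch space `L(G)` of a divisor `G = ∑ G(v) v`: the functions `f` with
`f = 0` or `ord_v f ≥ - G(v)` for every place `v`. -/
noncomputable def riemannRochSpace (G : Place F K →₀ ℤ) : Submodule F K where
  carrier := {f | ∀ (v : Place F K) (t : K), v.IsUniformizer t → v.val f ≤ v.val t ^ (-G v)}
  zero_mem' := fun v t _ => by simp
  add_mem' := fun {f g} hf hg v t ht =>
    (v.val.map_add f g).trans (max_le (hf v t ht) (hg v t ht))
  smul_mem' := fun c f hf v t ht => by
    rw [Algebra.smul_def, map_mul]
    exact (mul_le_of_le_one_left' (v.val_algebraMap_le_one c)).trans (hf v t ht)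

/-- The algebraic geometry code `C_L(D, G)` for `D = ∑ i, D i`: all vectors `(f(D i))_i` with
`f ∈ L(G)`. -/
noncomputable def agCode {ι : Type*} (D : ι → Place F K) (G : Place F K →₀ ℤ) :
    Submodule F (ι → F) where
  carrier := {c | ∃ f ∈ riemannRochSpace G, ∀ i, (D i).HasValue f (c i)}
  zero_mem' := ⟨0, Submodule.zero_mem _, fun i => by simp [Place.HasValue]⟩
  add_mem' := by
    rintro c d ⟨f, hf, hc⟩ ⟨g, hg, hd⟩
    refine ⟨f + g, Submodule.add_mem _ hf hg, fun i => ?_⟩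
    have h : f + g - algebraMap F K ((c + d) i)
        = (f - algebraMap F K (c i)) + (g - algebraMap F K (d i)) := by
      rw [Pi.add_apply, map_add]; ring
    unfold Place.HasValue
    rw [h]
    exact (D i).val.map_add_lt (hc i) (hd i)
  smul_mem' := by
    rintro a c ⟨f, hf, hc⟩
    refine ⟨a • f, Submodule.smul_mem _ a hf, fun i => ?_⟩
    have h : a • f - algebraMap F K ((a • c) i)
        = algebraMap F K a * (f - algebraMap F K (c i)) := by
      rw [Pi.smul_apply, smul_eq_mul, map_mul, Algebra.smul_def]; ring
    unfold Place.HasValue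
    rw [h, map_mul]
    exact (mul_le_of_le_one_left' ((D i).val_algebraMap_le_one a)).trans_lt (hc i)

end FunctionFields

section Codes

open Classical in
/-- `C` is a linear code with parameters `[n, k, d]`: its length is `n`, its dimension is `k`, and
`d` is its minimum distance, the smallest Hamming distance between two distinct codewords. -/
def HasParameters {F ι : Type*} [Field F] [Finite ι] (C : Submodule F (ι → F)) (n k d : ℕ) :
    Prop :=
  haveI : Fintype ι := Fintype.ofFinite ι
  Fintype.card ι = n ∧ Module.finrank F C = k ∧
    IsLeast {m : ℕ | ∃ x ∈ C, ∃ y ∈ C, x ≠ y ∧ hammingDist x y = m} d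

/-- The code generated by the rows of a matrix. -/
def codeGeneratedBy {F ι κ : Type*} [Field F] (M : Matrix κ ι F) : Submodule F (ι → F) :=
  Submodule.span F (Set.range fun i => M i)

end Codes

section EllipticCurves

open WeierstrassCurve

variable {F : Type*} [Field F]

/-- The coordinate function `x` of a Weierstrass curve, in its function field. -/
noncomputable def xFun (W : WeierstrassCurve F) : W.toAffine.FunctionField :=
  algebraMap W.toAffine.CoordinateRing W.toAffine.FunctionField
    (Affine.CoordinateRing.mk W.toAffine (Polynomial.C Polynomial.X))

/-- The coordinate function `y` of a Weierstrass curve, in its function field. -/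
noncomputable def yFun (W : WeierstrassCurve F) : W.toAffine.FunctionField :=
  algebraMap W.toAffine.CoordinateRing W.toAffine.FunctionField
    (Affine.CoordinateRing.mk W.toAffine Polynomial.X)

/-- The place `v` of the function field of `W` lies at the rational point `P` of `W`: if
`P = (a, b)`, then `x` has value `a` and `y` has value `b` at `v`; if `P` is the point at infinity,
then `x` has a pole at `v`. -/
def LiesAt (W : WeierstrassCurve F) (v : Place F W.toAffine.FunctionField) :
    W.toAffine.Point → Prop
  | .zero => 1 < v.val (xFun W)
  | .some a b _ => v.HasValue (xFun W) a ∧ v.HasValue (yFun W) b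

theorem exists_liesAt (W : WeierstrassCurve F) (P : W.toAffine.Point) :
    ∃ v : Place F W.toAffine.FunctionField, LiesAt W v P := by
  have hinj : Function.Injective
      (algebraMap W.toAffine.CoordinateRing W.toAffine.FunctionField) :=
    IsFractionRing.injective _ _
  have htr : ¬ IsIntegral F (xFun W) := by
    intro h
    have h1 : IsAlgebraic F (Polynomial.X : Polynomial F) := by
      have h2 : IsAlgebraic F (algebraMap (Polynomial F) W.toAffine.CoordinateRing
          Polynomial.X) :=
        (isAlgebraic_algebraMap_iff hinj).1 h.isAlgebraic
      exact (isAlgebraic_algebraMap_iff (FaithfulSMul.algebraMap_injective _ _)).1 h2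
    exact Polynomial.transcendental_X F h1
  match P with
  | .zero =>
    have h : xFun W ∉ (integralClosure (Subring.closure
        (Set.range (algebraMap F W.toAffine.FunctionField)))
        W.toAffine.FunctionField).toSubring := by
      intro h
      apply htr
      have hcl : Subring.closure (Set.range (algebraMap F W.toAffine.FunctionField))
          = (algebraMap F W.toAffine.FunctionField).range := by
        rw [← RingHom.coe_range, Subring.closure_eq]
      rw [hcl] at h
      obtain ⟨p, hp, hp0⟩ : IsIntegral (algebraMap F W.toAffine.FunctionField).range (xFun W) := h
      obtain ⟨p', h1, -, h3⟩ := Polynomial.lifts_and_natDegree_eq_and_monic (f :=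
        (algebraMap F W.toAffine.FunctionField).rangeRestrict) (p := p) (by
          rw [Polynomial.lifts_iff_coeff_lifts]
          exact fun n => RingHom.rangeRestrict_surjective _ _) hp
      refine ⟨p', h3, ?_⟩
      rw [← h1, Polynomial.eval₂_map] at hp0
      exact hp0
    rw [← iInf_valuationSubring_superset] at h
    simp only [Subring.mem_iInf, not_forall] at h
    obtain ⟨⟨V, hV⟩, hx⟩ := h
    refine ⟨⟨V, fun c => hV ⟨c, rfl⟩, ?_⟩, ?_⟩
    · rintro rfl
      exact hx (ValuationSubring.mem_top _)
    · exact lt_of_not_ge fun hle => hx ((V.valuation_le_one_iff _).1 hle)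
  | .some a b hab =>
    let R := (algebraMap W.toAffine.CoordinateRing W.toAffine.FunctionField).range
    let e : W.toAffine.CoordinateRing ≃+* R :=
      RingEquiv.ofBijective
        (algebraMap W.toAffine.CoordinateRing W.toAffine.FunctionField).rangeRestrict
        ⟨fun u w h => hinj (congrArg Subtype.val h), RingHom.rangeRestrict_surjective _⟩
    let I := Affine.CoordinateRing.XYIdeal W.toAffine a (Polynomial.C b)
    have hI : I ≠ ⊤ := by
      intro h
      have q := (Affine.CoordinateRing.quotientXYIdealEquiv (W' := W.toAffine) (x := a)
        (y := Polynomial.C b) hab.1)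
      have : Subsingleton (W.toAffine.CoordinateRing ⧸ I) :=
        Ideal.Quotient.subsingleton_iff.2 h
      exact not_subsingleton F (q.symm.toEquiv.subsingleton)
    have hJ : I.map (e : W.toAffine.CoordinateRing →+* R) ≠ ⊤ := by
      intro h
      apply hI
      rw [Ideal.eq_top_iff_one] at h ⊢
      obtain ⟨i, hi, h1⟩ := (Ideal.mem_map_of_equiv e 1).1 h
      rwa [e.map_eq_one_iff.1 h1] at hi
    obtain ⟨V, hV, hn⟩ := Ideal.image_subset_nonunits_valuationSubring _ hJ
    have key : ∀ r ∈ I, V.valuation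
        (algebraMap W.toAffine.CoordinateRing W.toAffine.FunctionField r) < 1 := fun r hr =>
      (V.mem_nonunits_iff).1 (hn ⟨e r, Ideal.mem_map_of_mem _ hr, rfl⟩)
    have hX := key (Affine.CoordinateRing.XClass W.toAffine a)
      (Ideal.subset_span (by simp))
    have hY := key (Affine.CoordinateRing.YClass W.toAffine (Polynomial.C b))
      (Ideal.subset_span (by simp))
    refine ⟨⟨V, fun c => hV ⟨algebraMap F _ c, ?_⟩, ?_⟩, ?_, ?_⟩
    · exact (IsScalarTower.algebraMap_apply F W.toAffine.CoordinateRing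
        W.toAffine.FunctionField c).symm
    · rintro rfl
      refine (ne_of_lt hX) (((⊤ : ValuationSubring W.toAffine.FunctionField).valuation_eq_one_iff
        ⟨_, ValuationSubring.mem_top _⟩).1 (isUnit_iff_exists_inv.2
        ⟨⟨_, ValuationSubring.mem_top (algebraMap W.toAffine.CoordinateRing
          W.toAffine.FunctionField (Affine.CoordinateRing.XClass W.toAffine a))⁻¹⟩,
          Subtype.ext (mul_inv_cancel₀ fun h0 => ?_)⟩))
      exact Affine.CoordinateRing.XClass_ne_zero a (hinj (h0.trans (map_zero _).symm))
    · have h : xFun W - algebraMap F W.toAffine.FunctionField a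
          = algebraMap W.toAffine.CoordinateRing W.toAffine.FunctionField
            (Affine.CoordinateRing.XClass W.toAffine a) := by
        rw [Affine.CoordinateRing.XClass, map_sub, map_sub, map_sub]
        rfl
      unfold Place.HasValue
      rw [h]
      exact hX
    · have h : yFun W - algebraMap F W.toAffine.FunctionField b
          = algebraMap W.toAffine.CoordinateRing W.toAffine.FunctionField
            (Affine.CoordinateRing.YClass W.toAffine (Polynomial.C b)) := by
        rw [Affine.CoordinateRing.YClass, map_sub, map_sub]
        rfl
      unfold Place.HasValue
      rw [h]
      exact hY

/-- The place of the function field of `W` that corresponds to the rational point `P` of `W`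
(on a nonsingular curve exactly one place lies at a given rational point). -/
noncomputable def pointPlace (W : WeierstrassCurve F) (P : W.toAffine.Point) :
    Place F W.toAffine.FunctionField :=
  (exists_liesAt W P).choose

instance finite_point [Finite F] (W : WeierstrassCurve F) : Finite W.toAffine.Point := by
  refine Finite.of_injective (β := Option (F × F)) (fun P => match P with
    | .zero => none
    | .some a b _ => some (a, b)) ?_
  rintro (_ | ⟨a, b, h⟩) (_ | ⟨a', b', h'⟩) hPQ <;> simp_all

/-- The divisor `P + (k - 1) Q`, for rational points `P` and `Q`. -/
noncomputable def twoPointDivisor (W : WeierstrassCurve F) (P Q : W.toAffine.Point) (k : ℕ) :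
    Place F W.toAffine.FunctionField →₀ ℤ :=
  Finsupp.single (pointPlace W P) 1 + Finsupp.single (pointPlace W Q) ((k : ℤ) - 1)

/-- The functions `f_2, …, f_{k-1}` and `g` lie in `L(P + (k - 1) Q)`; `f_i` has a pole of order
exactly `i` at `Q` and order `0` at `P`; and `g` has simple poles at `P` and at `Q`. (The other
values of the sequence `f` are irrelevant.) -/
def IsPoleSystem (W : WeierstrassCurve F) (P Q : W.toAffine.Point) (k : ℕ)
    (f : ℕ → W.toAffine.FunctionField) (g : W.toAffine.FunctionField) : Prop :=
  (∀ i : ℕ, 2 ≤ i → i < k → f i ∈ riemannRochSpace (twoPointDivisor W P Q k) ∧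
    (pointPlace W Q).HasOrd (f i) (-(i : ℤ)) ∧ (pointPlace W P).HasOrd (f i) 0) ∧
  g ∈ riemannRochSpace (twoPointDivisor W P Q k) ∧
    (pointPlace W P).HasOrd g (-1) ∧ (pointPlace W Q).HasOrd g (-1)

/-- The list of the `k` functions `1, f_2, …, f_{k-1}, g` (for `k ≥ 2`). -/
noncomputable def poleList {K : Type*} [Field K] (k : ℕ) (f : ℕ → K) (g : K) : Fin k → K :=
  fun i => if (i : ℕ) = 0 then 1 else if (i : ℕ) + 1 = k then g else f ((i : ℕ) + 1)

/-- The extended generator matrix: in the columns indexed by `some j` the values of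
`b_1, …, b_k` at the place `D j`, and one further column, indexed by `none`, that is `0` in all rows
but the last one and `1` in the last one. -/
noncomputable def extendedMatrix {K ι : Type*} [Field K] [Algebra F K] {k : ℕ}
    (D : ι → Place F K) (b : Fin k → K) : Matrix (Fin k) (Option ι) F
  | i, some j => (D j).value (b i)
  | i, none => if (i : ℕ) + 1 = k then 1 else 0

end EllipticCurves

/-!
The affine coordinate ring of an elliptic curve is a Dedekind domain
(`EllipticCode.isDedekindDomain_coordinateRing`): an element of the function field that is integral
but not in the ring would, through its trace and its norm to `F[x]`, produce a singular point of the
curve over a finite extension of `F`. Hence the places of the function field are the primes of the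
coordinate ring and one place at infinity, and the pole order at infinity of a regular function is
the degree of its norm to `F[x]`.

The link between functions and the group law is that the product of the ideals of rational points
`P₁, …, Pₙ` is principal if and only if `P₁ + ⋯ + Pₙ = 0`
(`EllipticCode.exists_span_eq_idealOf_iff`). It rests on the injectivity of the map from the points
to the class group of the coordinate ring, which Mathlib uses to prove associativity of the group
law. It has two consequences. If `f ≠ 0` has divisor at least `S - T` for effective sums `S`, `T` of
rational points of equal degree, then the points of `S` and of `T` have the same sum
(`EllipticCode.sum_eq_of_val_le`). For this, poles are cleared by vertical lines, and comparing the
resulting regular function with its conjugate under `P ↦ -P` shows that it has no unexpected zeros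
(`EllipticCode.span_eq_idealOf`). And `dim L(T) ≥ deg T` for every effective sum `T` of rational
points (`EllipticCode.exists_linearIndependent`).

Now let `H` have index two, `P ∈ H` and `Q ∉ H`. A sum of points of `H` lies in `H`, whereas `m Q`
does not if `m` is odd. So for `k` odd a nonzero function of `L(kQ)`, and for `k` even a nonzero
function of `L(P + (k - 1) Q)`, cannot vanish at `k` points of `H` (other than `P`). This makes
evaluation injective, gives the dimension of the Riemann-Roch spaces, and shows that the nonzero
words of the code have fewer than `k` zeros, which by the Singleton bound is the MDS property
(`EllipticCode.hasParameters_of_eq_zero`). The dimensions give functions with prescribed poles, and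
a pole system is linearly independent since its members have distinct pole orders at `Q`.

In the extended code a word that is zero at the appended coordinate belongs to a function of
`L((k - 1) Q)`. As `k - 1` is odd, such a nonzero function has at most `k - 2` zeros in `H`, so that
the word has at most `k - 1` zeros in all (`EllipticCode.hasParameters_extended`).
-/

namespace EllipticCode

open Polynomial WeierstrassCurve.Affine IsDedekindDomain
open scoped nonZeroDivisors

/-! ### Conjugation and the norm of the coordinate ring -/

section Conjugation

variable {F : Type*} [Field F] (W : WeierstrassCurve F)

theorem eval₂_negPolynomial :
    W.toAffine.polynomial.eval₂ (AdjoinRoot.of W.toAffine.polynomial)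
      (CoordinateRing.mk W.toAffine W.toAffine.negPolynomial) = 0 := by
  have h : CoordinateRing.mk W.toAffine (W.toAffine.negPolynomial ^ 2 +
      C (C W.a₁ * X + C W.a₃) * W.toAffine.negPolynomial -
      C (X ^ 3 + C W.a₂ * X ^ 2 + C W.a₄ * X + C W.a₆)) = 0 := by
    rw [AdjoinRoot.mk_eq_zero]
    exact ⟨1, by rw [negPolynomial, polynomial]; ring⟩
  rw [← h]
  change eval₂ _ _ (X ^ 2 + C (C W.a₁ * X + C W.a₃) * X -
    C (X ^ 3 + C W.a₂ * X ^ 2 + C W.a₄ * X + C W.a₆)) = _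
  simp only [eval₂_add, eval₂_sub, eval₂_mul, eval₂_pow, eval₂_C, eval₂_X, map_sub, map_add,
    map_mul, map_pow]
  rfl

/-- The conjugation of the coordinate ring: the involution induced by `P ↦ -P`, which fixes `x` and
sends `y` to `-y - a₁ x - a₃`. -/
noncomputable def conj : W.toAffine.CoordinateRing →+* W.toAffine.CoordinateRing :=
  AdjoinRoot.lift (AdjoinRoot.of W.toAffine.polynomial)
    (CoordinateRing.mk W.toAffine W.toAffine.negPolynomial) (eval₂_negPolynomial W)

variable {W}

theorem conj_mk_C (p : F[X]) :
    conj W (CoordinateRing.mk W.toAffine (C p)) = CoordinateRing.mk W.toAffine (C p) := by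
  rw [conj, AdjoinRoot.lift_mk, eval₂_C]
  rfl

theorem conj_algebraMap (p : F[X]) :
    conj W (algebraMap F[X] W.toAffine.CoordinateRing p) =
      algebraMap F[X] W.toAffine.CoordinateRing p :=
  conj_mk_C p

theorem conj_mk_Y :
    conj W (CoordinateRing.mk W.toAffine X) =
      CoordinateRing.mk W.toAffine W.toAffine.negPolynomial := by
  rw [conj, AdjoinRoot.lift_mk, eval₂_X]

theorem conj_smul (p : F[X]) (r : W.toAffine.CoordinateRing) :
    conj W (p • r) = p • conj W r := by
  rw [Algebra.smul_def, map_mul, conj_algebraMap, Algebra.smul_def]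

/-- The norm from the coordinate ring to `F[x]` is the product of the conjugates. -/
theorem algebraMap_norm (r : W.toAffine.CoordinateRing) :
    algebraMap F[X] W.toAffine.CoordinateRing (Algebra.norm F[X] r) = r * conj W r := by
  obtain ⟨p, q, rfl⟩ := CoordinateRing.exists_smul_basis_eq r
  have h := CoordinateRing.coe_norm_smul_basis (W' := W.toAffine) p q
  rw [map_add (conj W), conj_smul, conj_smul, map_one, conj_mk_Y]
  refine h.trans ?_
  simp only [CoordinateRing.smul, map_mul, map_add, negPolynomial, mul_one]

instance finite_coordinateRing : Module.Finite F[X] W.toAffine.CoordinateRing :=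
  .of_basis (CoordinateRing.basis W.toAffine)

theorem norm_ne_zero {r : W.toAffine.CoordinateRing} (hr : r ≠ 0) : Algebra.norm F[X] r ≠ 0 :=
  Algebra.norm_ne_zero_iff.2 hr

theorem norm_conj (r : W.toAffine.CoordinateRing) :
    Algebra.norm F[X] (conj W r) = Algebra.norm F[X] r := by
  obtain ⟨p, q, rfl⟩ := CoordinateRing.exists_smul_basis_eq r
  have h : conj W (p • 1 + q • CoordinateRing.mk W.toAffine X) =
      (p - q * (C W.a₁ * X + C W.a₃)) • (1 : W.toAffine.CoordinateRing) +
        (-q) • CoordinateRing.mk W.toAffine X := by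
    rw [map_add, conj_smul, conj_smul, map_one, conj_mk_Y]
    simp only [CoordinateRing.smul, map_mul, map_sub, negPolynomial, map_neg, map_add]
    ring
  rw [h, CoordinateRing.norm_smul_basis, CoordinateRing.norm_smul_basis]
  ring

theorem conj_injective : Function.Injective (conj W) := by
  rw [injective_iff_map_eq_zero]
  intro r hr
  by_contra h
  have := norm_ne_zero h
  rw [← norm_conj, hr] at this
  exact this Algebra.norm_zero

end Conjugation

/-! ### The coordinate ring of an elliptic curve is a Dedekind domain -/

section IntegrallyClosed

variable {F : Type*} [Field F] {W : WeierstrassCurve F}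

/-- The conjugate of an integral element of the function field, written with a denominator in
`F[x]`, is integral. -/
theorem isIntegral_conj {r : W.toAffine.CoordinateRing} {p : F[X]} {w : W.toAffine.FunctionField}
    (hw : w * algebraMap F[X] W.toAffine.FunctionField p =
      algebraMap W.toAffine.CoordinateRing W.toAffine.FunctionField r)
    (hint : IsIntegral F[X] w) :
    ∃ w', IsIntegral F[X] w' ∧ w' * algebraMap F[X] W.toAffine.FunctionField p =
      algebraMap W.toAffine.CoordinateRing W.toAffine.FunctionField (conj W r) := by
  let τ : W.toAffine.FunctionField →+* W.toAffine.FunctionField :=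
    IsFractionRing.map (conj_injective (W := W))
  have hτ : ∀ s, τ (algebraMap W.toAffine.CoordinateRing W.toAffine.FunctionField s) =
      algebraMap W.toAffine.CoordinateRing W.toAffine.FunctionField (conj W s) := fun s =>
    IsLocalization.map_eq _ s
  have hτ' : ∀ p : F[X], τ (algebraMap F[X] W.toAffine.FunctionField p) =
      algebraMap F[X] W.toAffine.FunctionField p := fun p => by
    rw [IsScalarTower.algebraMap_apply F[X] W.toAffine.CoordinateRing W.toAffine.FunctionField,
      hτ, conj_algebraMap]
  refine ⟨τ w, ?_, ?_⟩
  · exact hint.map_of_comp_eq (RingHom.id _) τ (RingHom.ext fun p => (hτ' p).symm)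
  · rw [← hτ, ← hw, map_mul, hτ']

/-- `F[x]` is integrally closed, also inside the function field of the curve. -/
theorem dvd_of_isIntegral {p a : F[X]} (hp : p ≠ 0) {z : W.toAffine.FunctionField}
    (hz : IsIntegral F[X] z) (h : z * algebraMap F[X] W.toAffine.FunctionField p =
      algebraMap F[X] W.toAffine.FunctionField a) : p ∣ a := by
  have hinj : Function.Injective (algebraMap F[X] W.toAffine.FunctionField) :=
    FaithfulSMul.algebraMap_injective _ _
  let ι : FractionRing F[X] →ₐ[F[X]] W.toAffine.FunctionField :=
    IsFractionRing.liftAlgHom (g := Algebra.ofId F[X] W.toAffine.FunctionField) hinj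
  have hp' : algebraMap F[X] (FractionRing F[X]) p ≠ 0 := by simpa using hp
  let z₀ := algebraMap F[X] (FractionRing F[X]) a / algebraMap F[X] (FractionRing F[X]) p
  have hz₀ : ι z₀ = z := by
    have : algebraMap F[X] W.toAffine.FunctionField p ≠ 0 := (map_ne_zero_iff _ hinj).2 hp
    rw [map_div₀, AlgHom.commutes, AlgHom.commutes, ← h, mul_div_cancel_right₀ _ this]
  have h1 : IsIntegral F[X] z₀ := (isIntegral_algHom_iff ι ι.toRingHom.injective).1 (hz₀ ▸ hz)
  obtain ⟨b, hb⟩ := IsIntegrallyClosed.isIntegral_iff.1 h1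
  refine ⟨b, IsFractionRing.injective F[X] (FractionRing F[X]) ?_⟩
  rw [map_mul, hb, mul_div_cancel₀ _ hp']

/-- A polynomial `y₀ ∈ F[x]` cannot satisfy the Weierstrass equation modulo `p ^ 2` and
`∂W/∂y = 0` modulo `p`: its reduction would give a singular point over `F[x] / (p)`. -/
theorem not_dvd_of_isElliptic [W.IsElliptic] {p y₀ : F[X]} (hp : Irreducible p)
    (h1 : p ^ 2 ∣ y₀ ^ 2 + (C W.a₁ * X + C W.a₃) * y₀ -
      (X ^ 3 + C W.a₂ * X ^ 2 + C W.a₄ * X + C W.a₆))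
    (h2 : p ∣ 2 * y₀ + (C W.a₁ * X + C W.a₃)) : False := by
  have hF : Fact (Irreducible p) := ⟨hp⟩
  obtain ⟨h, hh⟩ := h1
  have h3 : p ∣ C W.a₁ * y₀ - (3 * X ^ 2 + 2 * C W.a₂ * X + C W.a₄) := by
    have hd := congrArg derivative hh
    simp only [derivative_add, derivative_sub, derivative_mul, derivative_pow, derivative_C,
      derivative_X] at hd
    simp only [zero_mul, zero_add, mul_one, add_zero, map_ofNat, Nat.cast_ofNat, Nat.reduceSub,
      pow_one] at hd
    have : C W.a₁ * y₀ - (3 * X ^ 2 + 2 * C W.a₂ * X + C W.a₄) =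
        p * (2 * derivative p * h + p * derivative h) -
          (2 * y₀ + (C W.a₁ * X + C W.a₃)) * derivative y₀ := by
      linear_combination hd
    rw [this]
    exact dvd_sub (dvd_mul_right _ _) (dvd_mul_of_dvd_left h2 _)
  let α := AdjoinRoot.root p
  let φ : F[X] →+* AdjoinRoot p := AdjoinRoot.mk p
  have hφ : ∀ q, p ∣ q → φ q = 0 := fun q hq => AdjoinRoot.mk_eq_zero.2 hq
  have e1 := hφ _ (dvd_of_mul_left_dvd (a := p) ⟨h, by rw [hh]; ring⟩ :
    p ∣ y₀ ^ 2 + (C W.a₁ * X + C W.a₃) * y₀ - (X ^ 3 + C W.a₂ * X ^ 2 + C W.a₄ * X + C W.a₆))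
  have e2 := hφ _ h2
  have e3 := hφ _ h3
  have hC : ∀ c, φ (C c) = algebraMap F (AdjoinRoot p) c := fun c => rfl
  simp only [map_add, map_sub, map_mul, map_pow, hC, map_ofNat] at e1 e2 e3
  have hE : (W.map (algebraMap F (AdjoinRoot p))).toAffine.Equation (φ X) (φ y₀) := by
    rw [equation_iff']
    simp only [WeierstrassCurve.map_a₁, WeierstrassCurve.map_a₂, WeierstrassCurve.map_a₃,
      WeierstrassCurve.map_a₄, WeierstrassCurve.map_a₆]
    linear_combination e1
  rw [equation_iff_nonsingular, nonsingular_iff'] at hE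
  simp only [WeierstrassCurve.map_a₁, WeierstrassCurve.map_a₂, WeierstrassCurve.map_a₃,
    WeierstrassCurve.map_a₄] at hE
  rcases hE.2 with h | h
  · exact h (by linear_combination e3)
  · exact h (by linear_combination e2)

/-- The local step towards integral closedness: an integral element with an irreducible denominator
`p ∈ F[x]` lies in the coordinate ring. Otherwise its norm and trace would give a singular point
over `F[x] / (p)`. -/
theorem exists_eq_algebraMap_of_irreducible_mul [W.IsElliptic] {p : F[X]} (hp : Irreducible p)
    {w : W.toAffine.FunctionField} (hw : IsIntegral F[X] w) {r : W.toAffine.CoordinateRing}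
    (hr : w * algebraMap F[X] W.toAffine.FunctionField p =
      algebraMap W.toAffine.CoordinateRing W.toAffine.FunctionField r) :
    ∃ s, w = algebraMap W.toAffine.CoordinateRing W.toAffine.FunctionField s := by
  obtain ⟨w', hw', hr'⟩ := isIntegral_conj hr hw
  have hinj : Function.Injective
      (algebraMap W.toAffine.CoordinateRing W.toAffine.FunctionField) :=
    IsFractionRing.injective _ _
  have hpK : algebraMap F[X] W.toAffine.FunctionField p ≠ 0 :=
    (map_ne_zero_iff _ (FaithfulSMul.algebraMap_injective _ _)).2 hp.ne_zero
  have htow : ∀ q : F[X], algebraMap F[X] W.toAffine.FunctionField q =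
      algebraMap W.toAffine.CoordinateRing W.toAffine.FunctionField
        (algebraMap F[X] W.toAffine.CoordinateRing q) := fun q =>
    IsScalarTower.algebraMap_apply _ _ _ q
  obtain ⟨e, c, rfl⟩ := CoordinateRing.exists_smul_basis_eq r
  -- the trace `w + w'` and the norm `w * w'` are integral over `F[x]` and lie in `F(x)`
  have htr : p ∣ 2 * e - c * (C W.a₁ * X + C W.a₃) := by
    refine dvd_of_isIntegral hp.ne_zero (hw.add hw') ?_
    rw [add_mul, hr, hr', htow, ← map_add]
    rw [map_add (conj W), conj_smul, conj_smul, map_one, conj_mk_Y]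
    congr 1
    change _ = CoordinateRing.mk W.toAffine (C _)
    simp only [CoordinateRing.smul, negPolynomial, map_mul, map_sub, map_add, map_neg, map_ofNat]
    ring
  have hnm : p ^ 2 ∣ e ^ 2 - e * c * (C W.a₁ * X + C W.a₃) -
      c ^ 2 * (X ^ 3 + C W.a₂ * X ^ 2 + C W.a₄ * X + C W.a₆) := by
    refine dvd_of_isIntegral (pow_ne_zero 2 hp.ne_zero) (hw.mul hw') ?_
    have h := CoordinateRing.norm_smul_basis (W' := W.toAffine) e c
    rw [← h, map_pow, htow (Algebra.norm _ _), algebraMap_norm, map_mul, ← hr, ← hr']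
    ring
  by_cases hc : p ∣ c
  · have he : p ∣ e := by
      have h1 : p ∣ e ^ 2 := by
        have h2 : p ∣ p ^ 2 := dvd_pow_self p two_ne_zero
        have h3 := h2.trans hnm
        have h4 : e ^ 2 = (e ^ 2 - e * c * (C W.a₁ * X + C W.a₃) -
          c ^ 2 * (X ^ 3 + C W.a₂ * X ^ 2 + C W.a₄ * X + C W.a₆)) +
          c * (e * (C W.a₁ * X + C W.a₃) +
            c * (X ^ 3 + C W.a₂ * X ^ 2 + C W.a₄ * X + C W.a₆)) := by ring
        rw [h4]
        exact dvd_add h3 (dvd_mul_of_dvd_left hc _)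
      exact hp.prime.dvd_of_dvd_pow h1
    obtain ⟨e', rfl⟩ := he
    obtain ⟨c', rfl⟩ := hc
    refine ⟨e' • 1 + c' • CoordinateRing.mk W.toAffine X, mul_right_cancel₀ hpK ?_⟩
    rw [hr, htow, ← map_mul, mul_smul, mul_smul, ← smul_add, Algebra.smul_def, mul_comm]
  · exfalso
    have hcop : IsCoprime (p ^ 2) c :=
      IsCoprime.pow_left ((hp.coprime_iff_not_dvd).2 hc)
    obtain ⟨a, b, hab⟩ := hcop
    refine not_dvd_of_isElliptic (W := W) hp (y₀ := -e * b) ?_ ?_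
    · obtain ⟨m, hm⟩ := hnm
      set L := C W.a₁ * X + C W.a₃
      set f := X ^ 3 + C W.a₂ * X ^ 2 + C W.a₄ * X + C W.a₆
      refine ⟨b ^ 2 * m - e * b * L * a - f * a * (1 + b * c), ?_⟩
      linear_combination b ^ 2 * hm + (e * b * L + f * (1 + b * c)) * hab
    · obtain ⟨m, hm⟩ := htr
      refine ⟨-b * m + a * p * (C W.a₁ * X + C W.a₃), ?_⟩
      linear_combination -b * hm - (C W.a₁ * X + C W.a₃) * hab

theorem exists_eq_algebraMap_of_mul [W.IsElliptic] {d : F[X]} (hd : d ≠ 0)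
    (w : W.toAffine.FunctionField) (hw : IsIntegral F[X] w) (r : W.toAffine.CoordinateRing)
    (hr : w * algebraMap F[X] W.toAffine.FunctionField d =
      algebraMap W.toAffine.CoordinateRing W.toAffine.FunctionField r) :
    ∃ s, w = algebraMap W.toAffine.CoordinateRing W.toAffine.FunctionField s := by
  induction d using WfDvdMonoid.induction_on_irreducible generalizing w r with
  | zero => exact absurd rfl hd
  | unit u hu =>
    obtain ⟨v, hv⟩ := hu.exists_right_inv
    refine ⟨r * algebraMap F[X] _ v, ?_⟩
    rw [map_mul, ← hr, ← IsScalarTower.algebraMap_apply, mul_assoc, ← map_mul, hv, map_one, mul_one]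
  | mul a p ha hp ih =>
    have hint : IsIntegral F[X] (w * algebraMap F[X] W.toAffine.FunctionField p) :=
      hw.mul isIntegral_algebraMap
    obtain ⟨s, hs⟩ := ih ha _ hint r (by rw [← hr, map_mul, mul_assoc])
    exact exists_eq_algebraMap_of_irreducible_mul hp hw hs

/-- The affine coordinate ring of an elliptic curve is integrally closed. -/
theorem isIntegrallyClosed [W.IsElliptic] : IsIntegrallyClosed W.toAffine.CoordinateRing := by
  refine (isIntegrallyClosed_iff W.toAffine.FunctionField).2 fun {w} hw => ?_
  have hw' : IsIntegral F[X] w := isIntegral_trans (R := F[X]) w hw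
  obtain ⟨a, b, hb, rfl⟩ := IsFractionRing.div_surjective (A := W.toAffine.CoordinateRing) w
  have hb0 : b ≠ 0 := nonZeroDivisors.ne_zero hb
  obtain ⟨s, hs⟩ := exists_eq_algebraMap_of_mul (norm_ne_zero hb0) _ hw' (a * conj W b) (by
    rw [IsScalarTower.algebraMap_apply F[X] W.toAffine.CoordinateRing W.toAffine.FunctionField,
      algebraMap_norm, map_mul, map_mul, ← mul_assoc, div_mul_cancel₀]
    exact (map_ne_zero_iff _ (IsFractionRing.injective _ _)).2 hb0)
  exact ⟨s, hs.symm⟩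

instance isDedekindDomain_coordinateRing [W.IsElliptic] :
    IsDedekindDomain W.toAffine.CoordinateRing where
  __ := isIntegrallyClosed (W := W)
  __ := IsNoetherianRing.of_finite F[X] W.toAffine.CoordinateRing
  __ := Ring.DimensionLEOne.of_isIntegral F[X] W.toAffine.CoordinateRing

end IntegrallyClosed

/-! ### Valuations, values and uniformizers at a place -/

section Places

variable {F K : Type*} [Field F] [Field K] [Algebra F K] (v : Place F K)

theorem val_le_one_iff (f : K) : v.val f ≤ 1 ↔ f ∈ v.ring := v.ring.valuation_le_one_iff f

theorem place_ext {v w : Place F K} (h : v.ring = w.ring) : v = w := by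
  cases v; cases w; congr

theorem val_algebraMap {c : F} (hc : c ≠ 0) : v.val (algebraMap F K c) = 1 := by
  refine le_antisymm (v.val_algebraMap_le_one c) ?_
  have h : v.val (algebraMap F K c) * v.val (algebraMap F K c⁻¹) = 1 := by
    rw [← map_mul, ← map_mul, mul_inv_cancel₀ hc, map_one, map_one]
  exact h.ge.trans (mul_le_of_le_one_right' (v.val_algebraMap_le_one c⁻¹))

variable {v}

theorem _root_.Place.HasValue.unique {f : K} {c d : F} (hc : v.HasValue f c)
    (hd : v.HasValue f d) : c = d := by
  by_contra h
  have h1 := val_algebraMap v (sub_ne_zero.2 h)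
  have h2 : algebraMap F K (c - d) = (f - algebraMap F K d) - (f - algebraMap F K c) := by
    rw [map_sub]; ring
  rw [h2] at h1
  exact (v.val.map_sub_lt hd hc).ne h1

theorem _root_.Place.HasValue.value_eq {f : K} {c : F} (hc : v.HasValue f c) : v.value f = c := by
  have h : ∃ c, v.HasValue f c := ⟨c, hc⟩
  rw [Place.value, dif_pos h]
  exact Place.HasValue.unique h.choose_spec hc

theorem _root_.Place.HasValue.val_le_one {f : K} {c : F} (hc : v.HasValue f c) : v.val f ≤ 1 := by
  have h : f = (f - algebraMap F K c) + algebraMap F K c := by ring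
  rw [h]
  exact (v.val.map_add _ _).trans (max_le (le_of_lt hc) (v.val_algebraMap_le_one c))

theorem _root_.Place.HasValue.val_eq_one {f : K} {c : F} (hc : v.HasValue f c) (h0 : c ≠ 0) :
    v.val f = 1 := by
  have h1 := val_algebraMap v h0
  have h : v.val (f - algebraMap F K c) < v.val (algebraMap F K c) := h1.symm ▸ hc
  rw [← sub_add_cancel f (algebraMap F K c), Valuation.map_add_eq_of_lt_right _ h, h1]

theorem hasValue_zero_iff {f : K} : v.HasValue f 0 ↔ v.val f < 1 := by
  simp [Place.HasValue]

theorem hasValue_algebraMap (c : F) : v.HasValue (algebraMap F K c) c := by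
  simp [Place.HasValue]

theorem _root_.Place.HasValue.add {f g : K} {c d : F} (hc : v.HasValue f c) (hd : v.HasValue g d) :
    v.HasValue (f + g) (c + d) := by
  have h : f + g - algebraMap F K (c + d) = (f - algebraMap F K c) + (g - algebraMap F K d) := by
    rw [map_add]; ring
  unfold Place.HasValue
  rw [h]
  exact v.val.map_add_lt hc hd

theorem _root_.Place.HasValue.smul {f : K} {c : F} (a : F) (hc : v.HasValue f c) :
    v.HasValue (a • f) (a * c) := by
  have h : a • f - algebraMap F K (a * c) = algebraMap F K a * (f - algebraMap F K c) := by
    rw [map_mul, Algebra.smul_def]; ring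
  unfold Place.HasValue
  rw [h, map_mul]
  exact (mul_le_of_le_one_left' (v.val_algebraMap_le_one a)).trans_lt hc

theorem _root_.Place.IsUniformizer.ne_zero {t : K} (ht : v.IsUniformizer t) : t ≠ 0 := by
  rintro rfl
  apply v.ne_top
  rw [eq_top_iff]
  intro f _
  rw [← val_le_one_iff]
  by_contra! h
  have hf : f ≠ 0 := by rintro rfl; simp at h
  have h1 : v.val f⁻¹ < 1 := by
    rw [map_inv₀]
    exact inv_lt_one_of_one_lt₀ h
  have h2 := ht.2 _ h1
  rw [map_zero, le_zero_iff, map_eq_zero, inv_eq_zero] at h2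
  exact hf h2

theorem _root_.Place.IsUniformizer.val_pos {t : K} (ht : v.IsUniformizer t) : 0 < v.val t :=
  (Valuation.pos_iff _).2 (ht.ne_zero)

theorem _root_.Place.IsUniformizer.val_eq {t s : K} (ht : v.IsUniformizer t)
    (hs : v.IsUniformizer s) : v.val t = v.val s :=
  le_antisymm (hs.2 t ht.1) (ht.2 s hs.1)

theorem _root_.Place.IsUniformizer.zpow_le_iff {t : K} (ht : v.IsUniformizer t) {m n : ℤ} :
    v.val t ^ m ≤ v.val t ^ n ↔ n ≤ m :=
  zpow_le_zpow_iff_right_of_lt_one₀ (ht.val_pos) ht.1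

theorem _root_.Place.IsUniformizer.zpow_lt_iff {t : K} (ht : v.IsUniformizer t) {m n : ℤ} :
    v.val t ^ m < v.val t ^ n ↔ n < m :=
  zpow_lt_zpow_iff_right_of_lt_one₀ (ht.val_pos) ht.1

end Places

/-! ### Affine places are primes of the coordinate ring -/

section PlacesOfCurve

variable {F : Type*} [Field F] {W : WeierstrassCurve F}

theorem algebraMap_X :
    algebraMap F[X] W.toAffine.FunctionField X = xFun W :=
  IsScalarTower.algebraMap_apply F[X] W.toAffine.CoordinateRing W.toAffine.FunctionField X

theorem algebraMap_C (c : F) :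
    algebraMap F[X] W.toAffine.FunctionField (C c) = algebraMap F W.toAffine.FunctionField c :=
  (IsScalarTower.algebraMap_apply F F[X] W.toAffine.FunctionField c).symm

/-- The Weierstrass equation, in the function field. -/
theorem yFun_mul : yFun W * (yFun W + algebraMap F[X] W.toAffine.FunctionField
      (C W.a₁ * X + C W.a₃)) = algebraMap F[X] W.toAffine.FunctionField
      (X ^ 3 + C W.a₂ * X ^ 2 + C W.a₄ * X + C W.a₆) := by
  have h : CoordinateRing.mk W.toAffine (X * (X + C (C W.a₁ * X + C W.a₃))) =
      CoordinateRing.mk W.toAffine (C (X ^ 3 + C W.a₂ * X ^ 2 + C W.a₄ * X + C W.a₆)) :=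
    AdjoinRoot.mk_eq_mk.2 ⟨1, by rw [polynomial]; ring⟩
  have h' := congrArg (algebraMap W.toAffine.CoordinateRing W.toAffine.FunctionField) h
  rw [map_mul, map_add, map_mul, map_add] at h'
  exact h'

theorem algebraMap_smul_basis (p q : F[X]) :
    algebraMap W.toAffine.CoordinateRing W.toAffine.FunctionField
      (p • 1 + q • CoordinateRing.mk W.toAffine X) =
    algebraMap F[X] W.toAffine.FunctionField p + algebraMap F[X] W.toAffine.FunctionField q *
      yFun W := by
  rw [map_add, Algebra.smul_def, Algebra.smul_def, map_mul, map_mul, map_one, mul_one]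
  rfl

variable (v : Place F W.toAffine.FunctionField)

theorem val_poly_le_one (hx : v.val (xFun W) ≤ 1) (p : F[X]) :
    v.val (algebraMap F[X] W.toAffine.FunctionField p) ≤ 1 := by
  induction p using Polynomial.induction_on' with
  | add p q hp hq => rw [map_add]; exact (v.val.map_add _ _).trans (max_le hp hq)
  | monomial n a =>
    rw [← C_mul_X_pow_eq_monomial, map_mul, map_pow, algebraMap_C, algebraMap_X, map_mul, map_pow]
    exact mul_le_one' (v.val_algebraMap_le_one a) (pow_le_one' hx n)

theorem val_yFun_le_one (hx : v.val (xFun W) ≤ 1) : v.val (yFun W) ≤ 1 := by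
  by_contra! h
  have h1 := congrArg v.val (yFun_mul (W := W))
  rw [map_mul, Valuation.map_add_eq_of_lt_left _ ((val_poly_le_one v hx _).trans_lt h)] at h1
  have h2 := val_poly_le_one v hx (X ^ 3 + C W.a₂ * X ^ 2 + C W.a₄ * X + C W.a₆)
  rw [← h1] at h2
  exact absurd h2 (not_le.2 (one_lt_mul'' h h))

theorem val_coordinateRing_le_one (hx : v.val (xFun W) ≤ 1) (r : W.toAffine.CoordinateRing) :
    v.val (algebraMap _ W.toAffine.FunctionField r) ≤ 1 := by
  obtain ⟨p, q, rfl⟩ := CoordinateRing.exists_smul_basis_eq r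
  rw [algebraMap_smul_basis]
  refine (v.val.map_add _ _).trans (max_le (val_poly_le_one v hx p) ?_)
  rw [map_mul]
  exact mul_le_one' (val_poly_le_one v hx q) (val_yFun_le_one v hx)

/-- The prime ideal of the coordinate ring below a place at which `x` is regular. -/
def center (hx : v.val (xFun W) ≤ 1) : Ideal W.toAffine.CoordinateRing where
  carrier := {r | v.val (algebraMap _ W.toAffine.FunctionField r) < 1}
  zero_mem' := by simp
  add_mem' := fun {a b} ha hb => by
    rw [Set.mem_ofPred_eq, map_add]
    exact v.val.map_add_lt ha hb
  smul_mem' := fun c a ha => by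
    rw [Set.mem_ofPred_eq, smul_eq_mul, map_mul, map_mul]
    exact (mul_le_of_le_one_left' (val_coordinateRing_le_one v hx c)).trans_lt ha

theorem mem_center {hx : v.val (xFun W) ≤ 1} {r : W.toAffine.CoordinateRing} :
    r ∈ center v hx ↔ v.val (algebraMap _ W.toAffine.FunctionField r) < 1 := Iff.rfl

theorem center_isPrime (hx : v.val (xFun W) ≤ 1) : (center v hx).IsPrime where
  ne_top' := by
    rw [Ideal.ne_top_iff_one, mem_center, map_one, map_one]
    exact lt_irrefl _
  mem_or_mem' := fun {a b} h => by
    simp only [mem_center, map_mul] at h ⊢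
    by_contra! h'
    have ha := le_antisymm (val_coordinateRing_le_one v hx a) h'.1
    have hb := le_antisymm (val_coordinateRing_le_one v hx b) h'.2
    rw [ha, hb, mul_one] at h
    exact lt_irrefl _ h

theorem center_ne_bot (hx : v.val (xFun W) ≤ 1) : center v hx ≠ ⊥ := by
  intro h
  have h1 : ∀ r : W.toAffine.CoordinateRing, r ≠ 0 →
      v.val (algebraMap _ W.toAffine.FunctionField r) = 1 := fun r hr => by
    refine le_antisymm (val_coordinateRing_le_one v hx r) (not_lt.1 fun h2 => hr ?_)
    rwa [← mem_center (hx := hx), h, Ideal.mem_bot] at h2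
  apply v.ne_top
  rw [eq_top_iff]
  intro f _
  rw [← val_le_one_iff]
  obtain ⟨a, b, hb, rfl⟩ := IsFractionRing.div_surjective (A := W.toAffine.CoordinateRing) f
  rw [map_div₀, h1 b (nonZeroDivisors.ne_zero hb), div_one]
  exact val_coordinateRing_le_one v hx a

variable [W.IsElliptic]

/-- The prime of the coordinate ring below a place at which `x` is regular. -/
def centerPrime (hx : v.val (xFun W) ≤ 1) : HeightOneSpectrum W.toAffine.CoordinateRing :=
  ⟨center v hx, center_isPrime v hx, center_ne_bot v hx⟩

/-- A place at which `x` is regular is the adic valuation of its centre. -/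
theorem isEquiv_valuation_centerPrime (hx : v.val (xFun W) ≤ 1) :
    v.val.IsEquiv ((centerPrime v hx).valuation W.toAffine.FunctionField) := by
  have h : HeightOneSpectrum.valuationSubringAtPrime W.toAffine.FunctionField (centerPrime v hx) =
      v.ring := by
    refine ValuationSubring.eq_of_le_of_ne_top _ (fun f hf => ?_) v.ne_top
    rw [HeightOneSpectrum.valuationSubringAtPrime_eq_valuationSubring] at hf
    obtain ⟨n, d, hnd⟩ := HeightOneSpectrum.exists_primeCompl_mul_eq_of_integer _ f hf
    have hd : v.val (algebraMap _ W.toAffine.FunctionField (d : W.toAffine.CoordinateRing)) = 1 :=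
      le_antisymm (val_coordinateRing_le_one v hx _) (not_lt.1 fun h => d.2 h)
    have h1 := congrArg v.val hnd
    rw [map_mul, hd, mul_one] at h1
    rw [← val_le_one_iff, h1]
    exact val_coordinateRing_le_one v hx n
  rw [HeightOneSpectrum.valuationSubringAtPrime_eq_valuationSubring] at h
  have h2 := Valuation.isEquiv_valuation_valuationSubring
    ((centerPrime v hx).valuation W.toAffine.FunctionField)
  rw [h] at h2
  exact h2.symm

theorem exists_uniformizer_of_isEquiv {p : HeightOneSpectrum W.toAffine.CoordinateRing}
    (h : v.val.IsEquiv (p.valuation W.toAffine.FunctionField)) :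
    ∃ t : W.toAffine.CoordinateRing, t ∈ p.asIdeal ∧
      v.IsUniformizer (algebraMap _ W.toAffine.FunctionField t) ∧
      ∀ f ≠ 0, ∃ n : ℤ, v.val f = v.val (algebraMap _ W.toAffine.FunctionField t) ^ n := by
  obtain ⟨t, ht⟩ := p.intValuation_exists_uniformizer
  have ht' : p.valuation W.toAffine.FunctionField (algebraMap _ _ t) = WithZero.exp (-1) := by
    rw [HeightOneSpectrum.valuation_of_algebraMap, ht]
  have hpow : ∀ f ≠ 0, ∃ n : ℤ,
      p.valuation W.toAffine.FunctionField f = p.valuation W.toAffine.FunctionField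
        (algebraMap _ _ t) ^ n := fun f hf => by
    have hne := ((p.valuation W.toAffine.FunctionField).ne_zero_iff).2 hf
    refine ⟨-WithZero.log (p.valuation W.toAffine.FunctionField f), ?_⟩
    rw [ht', ← WithZero.exp_zsmul, smul_eq_mul, neg_mul_neg, mul_one, WithZero.exp_log hne]
  have hlt : p.valuation W.toAffine.FunctionField (algebraMap _ _ t) < 1 := by
    rw [ht', ← WithZero.exp_zero, WithZero.exp_lt_exp]; norm_num
  have hpos : 0 < p.valuation W.toAffine.FunctionField (algebraMap _ _ t) := by
    rw [ht']; exact WithZero.exp_pos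
  refine ⟨t, ?_, ⟨?_, fun s hs => ?_⟩, fun f hf => ?_⟩
  · rwa [← p.intValuation_lt_one_iff_mem,
      ← p.valuation_of_algebraMap (K := W.toAffine.FunctionField)]
  · exact (h.lt_one_iff_lt_one).2 hlt
  · rcases eq_or_ne s 0 with rfl | hs0
    · simp
    rw [h]
    obtain ⟨n, hn⟩ := hpow s hs0
    have hs' := (h.lt_one_iff_lt_one).1 hs
    rw [hn] at hs' ⊢
    rw [← zpow_zero (p.valuation W.toAffine.FunctionField (algebraMap _ _ t)),
      zpow_lt_zpow_iff_right_of_lt_one₀ hpos hlt] at hs'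
    nth_rw 2 [← zpow_one (p.valuation W.toAffine.FunctionField (algebraMap _ _ t))]
    rw [zpow_le_zpow_iff_right_of_lt_one₀ hpos hlt]
    omega
  · obtain ⟨n, hn⟩ := hpow f hf
    refine ⟨n, ?_⟩
    rw [← map_zpow₀] at hn ⊢
    exact h.eq_iff.2 hn

/-- The place attached to a prime of the coordinate ring. -/
noncomputable def primePlace (p : HeightOneSpectrum W.toAffine.CoordinateRing) :
    Place F W.toAffine.FunctionField where
  ring := (p.valuation W.toAffine.FunctionField).valuationSubring
  algebraMap_mem := fun c => by
    rw [IsScalarTower.algebraMap_apply F W.toAffine.CoordinateRing W.toAffine.FunctionField]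
    exact p.valuation_le_one _
  ne_top := by
    rw [ne_eq, Valuation.valuationSubring_eq_top_iff, not_not]
    infer_instance

theorem val_primePlace_le_one_iff (p : HeightOneSpectrum W.toAffine.CoordinateRing)
    (f : W.toAffine.FunctionField) :
    (primePlace (F := F) p).val f ≤ 1 ↔ p.valuation W.toAffine.FunctionField f ≤ 1 := by
  rw [val_le_one_iff]
  rfl

/-- A function that is regular at all affine places belongs to the coordinate ring. -/
theorem exists_eq_algebraMap_of_val_le_one {f : W.toAffine.FunctionField}
    (hf : ∀ v : Place F W.toAffine.FunctionField, v.val (xFun W) ≤ 1 → v.val f ≤ 1) :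
    ∃ r, algebraMap W.toAffine.CoordinateRing _ r = f := by
  refine HeightOneSpectrum.mem_integers_of_valuation_le_one _ f fun p => ?_
  rw [← val_primePlace_le_one_iff (F := F)]
  refine hf _ ?_
  rw [val_primePlace_le_one_iff]
  exact p.valuation_le_one _

end PlacesOfCurve

/-! ### The place at infinity -/

section Infinity

variable {F : Type*} [Field F] {W : WeierstrassCurve F}

/-- The degree of the norm to `F[x]` of an element of the coordinate ring; it is the pole order at
infinity (and `0` for the zero element). -/
noncomputable def normDegree (r : W.toAffine.CoordinateRing) : ℕ :=
  (Algebra.norm F[X] r).natDegree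

theorem normDegree_mul {r s : W.toAffine.CoordinateRing} (hr : r ≠ 0) (hs : s ≠ 0) :
    normDegree (r * s) = normDegree r + normDegree s := by
  rw [normDegree, map_mul, natDegree_mul (norm_ne_zero hr) (norm_ne_zero hs)]
  rfl

theorem normDegree_conj (r : W.toAffine.CoordinateRing) :
    normDegree (conj W r) = normDegree r := by
  rw [normDegree, norm_conj, normDegree]

theorem normDegree_smul_one (p : F[X]) :
    normDegree (p • (1 : W.toAffine.CoordinateRing)) = 2 * p.natDegree := by
  rw [normDegree, ← add_zero (p • (1 : W.toAffine.CoordinateRing)),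
    ← zero_smul F[X] (CoordinateRing.mk W.toAffine X), CoordinateRing.norm_smul_basis,
    show p ^ 2 - p * 0 * (C W.a₁ * X + C W.a₃) -
      0 ^ 2 * (X ^ 3 + C W.a₂ * X ^ 2 + C W.a₄ * X + C W.a₆) = p ^ 2 by ring, natDegree_pow]

theorem normDegree_smul_basis (p : F[X]) {q : F[X]} (hq : q ≠ 0) :
    normDegree (p • (1 : W.toAffine.CoordinateRing) + q • CoordinateRing.mk W.toAffine X) =
      max (2 * p.natDegree) (2 * q.natDegree + 3) := by
  rw [normDegree]
  refine natDegree_eq_of_degree_eq_some ?_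
  rw [CoordinateRing.degree_norm_smul_basis, degree_eq_natDegree hq]
  rcases eq_or_ne p 0 with rfl | hp
  · simp
  · rw [degree_eq_natDegree hp]
    simp only [nsmul_eq_mul]
    push_cast
    rfl

/-- Exactly one of the terms `p` and `q y` of a nonzero element `p + q y` dominates. -/
theorem normDegree_cases {p q : F[X]}
    (h : p • (1 : W.toAffine.CoordinateRing) + q • CoordinateRing.mk W.toAffine X ≠ 0) :
    ∃ D, normDegree (p • (1 : W.toAffine.CoordinateRing) + q • CoordinateRing.mk W.toAffine X) =
      D ∧ (p ≠ 0 ∧ D = 2 * p.natDegree ∧ (q = 0 ∨ 2 * q.natDegree + 3 < D) ∨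
        q ≠ 0 ∧ D = 2 * q.natDegree + 3 ∧ (p = 0 ∨ 2 * p.natDegree < D)) := by
  refine ⟨_, rfl, ?_⟩
  rcases eq_or_ne q 0 with rfl | hq
  · have hp : p ≠ 0 := by rintro rfl; simp at h
    left
    rw [zero_smul, add_zero, normDegree_smul_one]
    exact ⟨hp, rfl, Or.inl rfl⟩
  · rw [normDegree_smul_basis p hq]
    rcases eq_or_ne p 0 with rfl | hp
    · simp [hq]
    · rcases lt_or_gt_of_ne (show 2 * p.natDegree ≠ 2 * q.natDegree + 3 by omega) with h | h
      · rw [max_eq_right h.le]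
        exact Or.inr ⟨hq, rfl, Or.inr h⟩
      · rw [max_eq_left h.le]
        exact Or.inl ⟨hp, rfl, Or.inr h⟩

theorem sub_C_mul_eq_zero_or {p q : F[X]} {a n : ℕ} (hp : p = 0 ∨ 2 * p.natDegree + a < n)
    (hq : q = 0 ∨ 2 * q.natDegree + a < n) (c : F) :
    p - C c * q = 0 ∨ 2 * (p - C c * q).natDegree + a < n := by
  have h1 := natDegree_C_mul_le c q
  rcases hp with rfl | hp <;> rcases hq with rfl | hq
  · simp
  · right
    rw [zero_sub, natDegree_neg]
    omega
  · right
    simpa using hp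
  · right
    have := natDegree_sub_le p (C c * q)
    omega

variable {v : Place F W.toAffine.FunctionField}

theorem val_poly_of_one_lt (hx : 1 < v.val (xFun W)) {p : F[X]} (hp : p ≠ 0) :
    v.val (algebraMap F[X] W.toAffine.FunctionField p) = v.val (xFun W) ^ p.natDegree := by
  have hterm : ∀ (c : F) (n : ℕ), c ≠ 0 →
      v.val (algebraMap F[X] W.toAffine.FunctionField (C c * X ^ n)) = v.val (xFun W) ^ n :=
    fun c n hc => by
      rw [map_mul, map_pow, algebraMap_C, algebraMap_X, map_mul, map_pow, val_algebraMap v hc,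
        one_mul]
  induction h : p.natDegree using Nat.strong_induction_on generalizing p with
  | _ n ih =>
    have hlead := hterm p.leadingCoeff p.natDegree (leadingCoeff_ne_zero.2 hp)
    rw [← p.eraseLead_add_C_mul_X_pow, map_add]
    rcases eq_or_ne p.eraseLead 0 with h0 | h0
    · rw [h0, map_zero, zero_add, hlead, h]
    · have hlt : p.eraseLead.natDegree < p.natDegree :=
        (eraseLead_natDegree_lt_or_eraseLead_eq_zero p).resolve_right h0
      rw [Valuation.map_add_eq_of_lt_right, hlead, h]
      rw [hlead, ih _ (h ▸ hlt) h0 rfl]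
      exact pow_lt_pow_right₀ hx hlt

theorem val_poly_le_of_one_lt (hx : 1 < v.val (xFun W)) (p : F[X]) {n : ℕ}
    (hn : p.natDegree ≤ n) :
    v.val (algebraMap F[X] W.toAffine.FunctionField p) ≤ v.val (xFun W) ^ n := by
  rcases eq_or_ne p 0 with rfl | hp
  · simp
  · rw [val_poly_of_one_lt hx hp]
    exact pow_le_pow_right₀ hx.le hn

theorem val_yFun_sq (hx : 1 < v.val (xFun W)) : v.val (yFun W) ^ 2 = v.val (xFun W) ^ 3 := by
  have hL := val_poly_le_of_one_lt hx (C W.a₁ * X + C W.a₃) natDegree_linear_le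
  rw [pow_one] at hL
  have hf := val_poly_of_one_lt hx (p := X ^ 3 + C W.a₂ * X ^ 2 + C W.a₄ * X + C W.a₆)
    (by rw [← one_mul (X ^ 3), ← C_1]
        exact ne_zero_of_natDegree_gt (n := 2) (by rw [natDegree_cubic one_ne_zero]; norm_num))
  have hdeg : (X ^ 3 + C W.a₂ * X ^ 2 + C W.a₄ * X + C W.a₆).natDegree = 3 := by
    rw [← one_mul (X ^ 3), ← C_1, natDegree_cubic one_ne_zero]
  rw [hdeg] at hf
  have h := congrArg v.val (yFun_mul (W := W))
  rw [map_mul, hf] at h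
  have hlt : v.val (xFun W) < v.val (yFun W) := by
    by_contra! hle
    have h1 : v.val (yFun W + algebraMap F[X] W.toAffine.FunctionField
        (C W.a₁ * X + C W.a₃)) ≤ v.val (xFun W) :=
      (v.val.map_add _ _).trans (max_le hle hL)
    have h2 := mul_le_mul' hle h1
    rw [h, ← sq] at h2
    exact absurd h2 (not_le.2 (pow_lt_pow_right₀ hx (by norm_num)))
  rw [Valuation.map_add_eq_of_lt_left _ (hL.trans_lt hlt), ← sq] at h
  exact h

theorem xFun_ne_zero (hx : 1 < v.val (xFun W)) : xFun W ≠ 0 := by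
  intro h
  simp [h] at hx

theorem yFun_ne_zero (hx : 1 < v.val (xFun W)) : yFun W ≠ 0 := by
  intro h
  have h1 := val_yFun_sq hx
  rw [h, map_zero, zero_pow two_ne_zero] at h1
  exact pow_ne_zero 3 (v.val.ne_zero_iff.2 (xFun_ne_zero hx)) h1.symm

theorem val_div_pos (hx : 1 < v.val (xFun W)) : 0 < v.val (xFun W / yFun W) :=
  (Valuation.pos_iff _).2 (div_ne_zero (xFun_ne_zero hx) (yFun_ne_zero hx))

theorem val_xFun_eq (hx : 1 < v.val (xFun W)) :
    v.val (xFun W) = v.val (xFun W / yFun W) ^ (-2 : ℤ) := by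
  have hx0 := v.val.ne_zero_iff.2 (xFun_ne_zero hx)
  have hy0 := v.val.ne_zero_iff.2 (yFun_ne_zero hx)
  have h := val_yFun_sq hx
  rw [map_div₀, zpow_neg, div_zpow, inv_div, eq_div_iff (zpow_ne_zero _ hx0)]
  exact_mod_cast (by rw [h, ← pow_succ'] : v.val (xFun W) * v.val (xFun W) ^ 2 = v.val (yFun W) ^ 2)

theorem val_yFun_eq (hx : 1 < v.val (xFun W)) :
    v.val (yFun W) = v.val (xFun W / yFun W) ^ (-3 : ℤ) := by
  have hx0 := v.val.ne_zero_iff.2 (xFun_ne_zero hx)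
  have hy0 := v.val.ne_zero_iff.2 (yFun_ne_zero hx)
  have h := val_yFun_sq hx
  rw [map_div₀, zpow_neg, div_zpow, inv_div, eq_div_iff (zpow_ne_zero _ hx0)]
  exact_mod_cast (by rw [← h, ← pow_succ'] :
    v.val (yFun W) * v.val (xFun W) ^ 3 = v.val (yFun W) ^ 3)

theorem val_div_lt_one (hx : 1 < v.val (xFun W)) : v.val (xFun W / yFun W) < 1 := by
  by_contra! h
  have h1 := val_xFun_eq hx
  rw [zpow_neg] at h1
  have h2 : 1 ≤ v.val (xFun W / yFun W) ^ (2 : ℤ) := one_le_zpow₀ h (by norm_num)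
  rw [h1] at hx
  exact absurd hx (not_lt.2 (inv_le_one_of_one_le₀ h2))

theorem zpow_le_zpow_iff_infinity (hx : 1 < v.val (xFun W)) {m n : ℤ} :
    v.val (xFun W / yFun W) ^ m ≤ v.val (xFun W / yFun W) ^ n ↔ n ≤ m :=
  zpow_le_zpow_iff_right_of_lt_one₀ (val_div_pos hx) (val_div_lt_one hx)

theorem zpow_lt_zpow_iff_infinity (hx : 1 < v.val (xFun W)) {m n : ℤ} :
    v.val (xFun W / yFun W) ^ m < v.val (xFun W / yFun W) ^ n ↔ n < m :=
  zpow_lt_zpow_iff_right_of_lt_one₀ (val_div_pos hx) (val_div_lt_one hx)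

theorem val_poly_infinity (hx : 1 < v.val (xFun W)) {p : F[X]} (hp : p ≠ 0) :
    v.val (algebraMap F[X] W.toAffine.FunctionField p) =
      v.val (xFun W / yFun W) ^ (-(2 * p.natDegree : ℕ) : ℤ) := by
  rw [val_poly_of_one_lt hx hp]
  nth_rw 1 [val_xFun_eq hx]
  rw [← zpow_natCast, ← zpow_mul]
  congr 1

theorem val_poly_mul_yFun (hx : 1 < v.val (xFun W)) {q : F[X]} (hq : q ≠ 0) :
    v.val (algebraMap F[X] W.toAffine.FunctionField q * yFun W) =
      v.val (xFun W / yFun W) ^ (-(2 * q.natDegree + 3 : ℕ) : ℤ) := by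
  have h0 : v.val (xFun W / yFun W) ≠ 0 := (val_div_pos hx).ne'
  rw [map_mul, val_poly_infinity hx hq, val_yFun_eq hx, ← zpow_add₀ h0]
  congr 1
  push_cast
  ring

/-- At a place at infinity the pole order of a regular function is the degree of its norm: the
terms `p` and `q y` of `p + q y` have different pole orders, one even and one odd. -/
theorem val_infinity (hx : 1 < v.val (xFun W)) {r : W.toAffine.CoordinateRing} (hr : r ≠ 0) :
    v.val (algebraMap _ W.toAffine.FunctionField r) =
      v.val (xFun W / yFun W) ^ (-(normDegree r : ℤ)) := by
  obtain ⟨p, q, rfl⟩ := CoordinateRing.exists_smul_basis_eq r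
  rw [algebraMap_smul_basis]
  rcases eq_or_ne q 0 with rfl | hq
  · have hp : p ≠ 0 := by rintro rfl; simp at hr
    rw [map_zero, zero_mul, add_zero, zero_smul, add_zero, normDegree_smul_one,
      val_poly_infinity hx hp]
  rw [normDegree_smul_basis p hq]
  rcases eq_or_ne p 0 with rfl | hp
  · rw [map_zero, zero_add, val_poly_mul_yFun hx hq]
    simp
  rcases lt_or_gt_of_ne (show 2 * p.natDegree ≠ 2 * q.natDegree + 3 by omega) with h | h
  · rw [max_eq_right h.le, Valuation.map_add_eq_of_lt_right, val_poly_mul_yFun hx hq]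
    rw [val_poly_infinity hx hp, val_poly_mul_yFun hx hq, zpow_lt_zpow_iff_infinity hx]
    omega
  · rw [max_eq_left h.le, Valuation.map_add_eq_of_lt_left, val_poly_infinity hx hp]
    rw [val_poly_infinity hx hp, val_poly_mul_yFun hx hq, zpow_lt_zpow_iff_infinity hx]
    omega

theorem val_div_infinity (hx : 1 < v.val (xFun W)) {a b : W.toAffine.CoordinateRing} (ha : a ≠ 0)
    (hb : b ≠ 0) :
    v.val (algebraMap _ W.toAffine.FunctionField a / algebraMap _ W.toAffine.FunctionField b) =
      v.val (xFun W / yFun W) ^ ((normDegree b : ℤ) - normDegree a) := by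
  rw [map_div₀, val_infinity hx ha, val_infinity hx hb, ← zpow_sub₀ (val_div_pos hx).ne']
  congr 1
  ring

theorem exists_val_eq_zpow_infinity (hx : 1 < v.val (xFun W)) {f : W.toAffine.FunctionField}
    (hf : f ≠ 0) : ∃ n : ℤ, v.val f = v.val (xFun W / yFun W) ^ n := by
  obtain ⟨a, b, hb, rfl⟩ := IsFractionRing.div_surjective (A := W.toAffine.CoordinateRing) f
  have ha : a ≠ 0 := by rintro rfl; simp at hf
  exact ⟨_, val_div_infinity hx ha (nonZeroDivisors.ne_zero hb)⟩

theorem isUniformizer_infinity (hx : 1 < v.val (xFun W)) :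
    v.IsUniformizer (xFun W / yFun W) := by
  refine ⟨val_div_lt_one hx, fun s hs => ?_⟩
  rcases eq_or_ne s 0 with rfl | hs0
  · simp
  obtain ⟨n, hn⟩ := exists_val_eq_zpow_infinity hx hs0
  rw [hn, ← zpow_zero (v.val (xFun W / yFun W)), zpow_lt_zpow_iff_infinity hx] at hs
  rw [hn]
  nth_rw 2 [← zpow_one (v.val (xFun W / yFun W))]
  rw [zpow_le_zpow_iff_infinity hx]
  omega

/-- There is only one place at infinity. -/
theorem infinity_unique {w : Place F W.toAffine.FunctionField} (hv : 1 < v.val (xFun W))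
    (hw : 1 < w.val (xFun W)) : v = w := by
  apply place_ext
  ext f
  rw [← val_le_one_iff, ← val_le_one_iff]
  obtain ⟨a, b, hb, rfl⟩ := IsFractionRing.div_surjective (A := W.toAffine.CoordinateRing) f
  rcases eq_or_ne a 0 with rfl | ha
  · simp
  have hb' := nonZeroDivisors.ne_zero hb
  rw [val_div_infinity hv ha hb', val_div_infinity hw ha hb',
    ← zpow_zero (v.val (xFun W / yFun W)), ← zpow_zero (w.val (xFun W / yFun W)),
    zpow_le_zpow_iff_infinity hv, zpow_le_zpow_iff_infinity hw]

theorem val_poly_lt_iff (hx : 1 < v.val (xFun W)) {p : F[X]} {n : ℤ} :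
    v.val (algebraMap F[X] W.toAffine.FunctionField p) < v.val (xFun W / yFun W) ^ (-n) ↔
      p = 0 ∨ (2 * p.natDegree : ℤ) < n := by
  rcases eq_or_ne p 0 with rfl | hp
  · simpa using zpow_pos (val_div_pos hx) _
  · rw [val_poly_infinity hx hp, zpow_lt_zpow_iff_infinity hx]
    simp [hp]

theorem val_poly_mul_yFun_lt_iff (hx : 1 < v.val (xFun W)) {q : F[X]} {n : ℤ} :
    v.val (algebraMap F[X] W.toAffine.FunctionField q * yFun W) <
        v.val (xFun W / yFun W) ^ (-n) ↔ q = 0 ∨ (2 * q.natDegree + 3 : ℤ) < n := by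
  rcases eq_or_ne q 0 with rfl | hq
  · simpa using zpow_pos (val_div_pos hx) _
  · rw [val_poly_mul_yFun hx hq, zpow_lt_zpow_iff_infinity hx]
    simp [hq]

/-- Two polynomials of the same degree have proportional leading terms. -/
theorem exists_degree_sub_C_mul_lt {p q : F[X]} (hp : p ≠ 0) (hq : q ≠ 0)
    (h : p.natDegree = q.natDegree) :
    ∃ c, p - C c * q = 0 ∨ (p - C c * q).natDegree < q.natDegree := by
  have hlq := leadingCoeff_ne_zero.2 hq
  have hlp := leadingCoeff_ne_zero.2 hp
  refine ⟨p.leadingCoeff / q.leadingCoeff, ?_⟩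
  have hc : p.leadingCoeff / q.leadingCoeff ≠ 0 := div_ne_zero hlp hlq
  have h1 : (p - C (p.leadingCoeff / q.leadingCoeff) * q).degree < p.degree := by
    refine degree_sub_lt_left ?_ hp ?_
    · rw [degree_C_mul hc, degree_eq_natDegree hp, degree_eq_natDegree hq, h]
    · rw [leadingCoeff_mul, leadingCoeff_C, div_mul_cancel₀ _ hlq]
  rcases eq_or_ne (p - C (p.leadingCoeff / q.leadingCoeff) * q) 0 with h0 | h0
  · exact Or.inl h0
  · right
    rw [← h]
    exact natDegree_lt_natDegree h0 h1

/-- Two regular functions with the same pole order at infinity are proportional up to a function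
with a smaller pole order. -/
theorem exists_val_sub_lt (hx : 1 < v.val (xFun W)) {r s : W.toAffine.CoordinateRing}
    (hr : r ≠ 0) (hs : s ≠ 0) (h : normDegree r = normDegree s) :
    ∃ c : F, v.val (algebraMap _ W.toAffine.FunctionField r - algebraMap F _ c *
      algebraMap _ W.toAffine.FunctionField s) < v.val (algebraMap _ _ s) := by
  rw [val_infinity hx hs]
  obtain ⟨p, q, rfl⟩ := CoordinateRing.exists_smul_basis_eq r
  obtain ⟨p', q', rfl⟩ := CoordinateRing.exists_smul_basis_eq s
  -- it suffices to make both components small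
  suffices hc : ∃ c : F, (p - C c * p' = 0 ∨ 2 * (p - C c * p').natDegree <
      normDegree (p' • (1 : W.toAffine.CoordinateRing) + q' • CoordinateRing.mk W.toAffine X)) ∧
      (q - C c * q' = 0 ∨ 2 * (q - C c * q').natDegree + 3 <
      normDegree (p' • (1 : W.toAffine.CoordinateRing) + q' • CoordinateRing.mk W.toAffine X)) by
    obtain ⟨c, h1, h2⟩ := hc
    refine ⟨c, ?_⟩
    have e : algebraMap _ W.toAffine.FunctionField
          (p • (1 : W.toAffine.CoordinateRing) + q • CoordinateRing.mk W.toAffine X) -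
        algebraMap F _ c * algebraMap _ W.toAffine.FunctionField
          (p' • (1 : W.toAffine.CoordinateRing) + q' • CoordinateRing.mk W.toAffine X) =
        algebraMap F[X] _ (p - C c * p') + algebraMap F[X] _ (q - C c * q') * yFun W := by
      rw [algebraMap_smul_basis, algebraMap_smul_basis, map_sub, map_sub, map_mul, map_mul,
        algebraMap_C]
      ring
    rw [e]
    refine v.val.map_add_lt ((val_poly_lt_iff hx).2 ?_) ((val_poly_mul_yFun_lt_iff hx).2 ?_)
    · exact_mod_cast h1
    · exact_mod_cast h2
  obtain ⟨D, hD, hr⟩ := normDegree_cases hr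
  obtain ⟨D', hD', hs⟩ := normDegree_cases hs
  rw [hD, hD'] at h
  subst h
  rw [hD']
  rcases hr with ⟨hp, hpD, hq⟩ | ⟨hq, hqD, hp⟩ <;>
    rcases hs with ⟨hp', hpD', hq'⟩ | ⟨hq', hqD', hp'⟩
  · obtain ⟨c, hc⟩ := exists_degree_sub_C_mul_lt hp hp' (by omega)
    exact ⟨c, hc.imp_right fun h => by omega, sub_C_mul_eq_zero_or hq hq' c⟩
  · omega
  · omega
  · obtain ⟨c, hc⟩ := exists_degree_sub_C_mul_lt hq hq' (by omega)
    exact ⟨c, sub_C_mul_eq_zero_or (a := 0) hp hp' c, hc.imp_right fun h => by omega⟩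

/-- Every function that is regular at infinity has a value in `F` there. -/
theorem exists_hasValue_infinity (hx : 1 < v.val (xFun W)) {f : W.toAffine.FunctionField}
    (hf : v.val f ≤ 1) : ∃ c : F, v.HasValue f c := by
  rcases hf.lt_or_eq with hf | hf
  · exact ⟨0, hasValue_zero_iff.2 hf⟩
  obtain ⟨a, b, hb, rfl⟩ := IsFractionRing.div_surjective (A := W.toAffine.CoordinateRing) f
  have ha : a ≠ 0 := by rintro rfl; simp at hf
  have hb' := nonZeroDivisors.ne_zero hb
  have hbK : algebraMap _ W.toAffine.FunctionField b ≠ 0 :=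
    (map_ne_zero_iff _ (IsFractionRing.injective _ _)).2 hb'
  have hdeg : normDegree a = normDegree b := by
    rw [val_div_infinity hx ha hb', ← zpow_zero (v.val (xFun W / yFun W))] at hf
    have h1 := (zpow_le_zpow_iff_infinity hx).1 hf.le
    have h2 := (zpow_le_zpow_iff_infinity hx).1 hf.ge
    omega
  obtain ⟨c, hc⟩ := exists_val_sub_lt hx ha hb' hdeg
  refine ⟨c, ?_⟩
  unfold Place.HasValue
  rw [div_sub' hbK, map_div₀, div_lt_one₀ ((Valuation.pos_iff _).2 hbK), mul_comm]
  exact hc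

end Infinity

/-! ### Places at rational points -/

section Points

variable {F : Type*} [Field F] {W : WeierstrassCurve F}

theorem liesAt_pointPlace (P : W.toAffine.Point) : LiesAt W (pointPlace W P) P :=
  (exists_liesAt W P).choose_spec

theorem liesAt_unique {v : Place F W.toAffine.FunctionField} {P Q : W.toAffine.Point}
    (hP : LiesAt W v P) (hQ : LiesAt W v Q) : P = Q := by
  match P, Q with
  | .zero, .zero => rfl
  | .zero, .some a b h => exact absurd hQ.1.val_le_one (not_le.2 hP)
  | .some a b h, .zero => exact absurd hP.1.val_le_one (not_le.2 hQ)
  | .some a b h, .some a' b' h' =>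
    obtain rfl := hP.1.unique hQ.1
    obtain rfl := hP.2.unique hQ.2
    rfl

theorem pointPlace_injective : Function.Injective (pointPlace W) := fun P Q h =>
  liesAt_unique (liesAt_pointPlace P) (h ▸ liesAt_pointPlace Q)

theorem one_lt_val_pointPlace_zero : 1 < (pointPlace W 0).val (xFun W) :=
  liesAt_pointPlace 0

theorem eq_pointPlace_zero {v : Place F W.toAffine.FunctionField} (h : ¬ v.val (xFun W) ≤ 1) :
    v = pointPlace W 0 :=
  infinity_unique (not_le.1 h) one_lt_val_pointPlace_zero

theorem val_xFun_pointPlace_le_one {P : W.toAffine.Point} (hP : P ≠ 0) :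
    (pointPlace W P).val (xFun W) ≤ 1 := by
  match P, hP with
  | .zero, hP => exact absurd rfl hP
  | .some a b h, _ => exact (liesAt_pointPlace (.some a b h)).1.val_le_one

variable (W) in
/-- The ideal of the coordinate ring of functions vanishing at a rational point: `(x - a, y - b)` at
the affine point `(a, b)`, and the unit ideal at the point at infinity. -/
noncomputable def pointIdeal : W.toAffine.Point → Ideal W.toAffine.CoordinateRing
  | .zero => ⊤
  | .some a b _ => CoordinateRing.XYIdeal W.toAffine a (C b)

theorem pointIdeal_zero : pointIdeal W 0 = ⊤ := rfl

theorem pointIdeal_some {a b : F} (h : W.toAffine.Nonsingular a b) :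
    pointIdeal W (.some a b h) = CoordinateRing.XYIdeal W.toAffine a (C b) := rfl

theorem pointIdeal_isMaximal {P : W.toAffine.Point} (hP : P ≠ 0) : (pointIdeal W P).IsMaximal := by
  match P, hP with
  | .zero, hP => exact absurd rfl hP
  | .some a b h, _ =>
    refine Ideal.Quotient.maximal_of_isField _ ?_
    exact MulEquiv.isField (Field.toIsField F)
      (CoordinateRing.quotientXYIdealEquiv (W' := W.toAffine) (y := C b) h.1).toMulEquiv

theorem XClass_eq (a : F) : algebraMap _ W.toAffine.FunctionField
    (CoordinateRing.XClass W.toAffine a) = xFun W - algebraMap F _ a := by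
  rw [CoordinateRing.XClass, map_sub, map_sub, map_sub]
  rfl

theorem YClass_eq (b : F) : algebraMap _ W.toAffine.FunctionField
    (CoordinateRing.YClass W.toAffine (C b)) = yFun W - algebraMap F _ b := by
  rw [CoordinateRing.YClass, map_sub, map_sub]
  rfl

theorem center_pointPlace {P : W.toAffine.Point} (hP : P ≠ 0) :
    center (pointPlace W P) (val_xFun_pointPlace_le_one hP) = pointIdeal W P := by
  refine ((pointIdeal_isMaximal hP).eq_of_le (center_isPrime _ _).ne_top ?_).symm
  match P, hP with
  | .zero, hP => exact absurd rfl hP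
  | .some a b h, _ =>
    have hl := liesAt_pointPlace (Point.some a b h)
    rw [pointIdeal_some, CoordinateRing.XYIdeal, Ideal.span_le]
    rintro r (rfl | rfl)
    · change Place.val _ _ < 1
      rw [XClass_eq]
      exact hl.1
    · change Place.val _ _ < 1
      rw [YClass_eq]
      exact hl.2

/-- Every element of the coordinate ring is constant modulo the ideal of an affine point. -/
theorem exists_sub_mem_pointIdeal {P : W.toAffine.Point} (hP : P ≠ 0)
    (r : W.toAffine.CoordinateRing) :
    ∃ c : F, r - algebraMap F _ c ∈ pointIdeal W P := by
  match P, hP with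
  | .zero, hP => exact absurd rfl hP
  | .some a b h, _ =>
    let e := CoordinateRing.quotientXYIdealEquiv (W' := W.toAffine) (y := C b) h.1
    refine ⟨e (Ideal.Quotient.mk _ r), ?_⟩
    rw [pointIdeal_some, ← Ideal.Quotient.eq]
    apply e.injective
    have : Ideal.Quotient.mk (CoordinateRing.XYIdeal W.toAffine a (C b))
        (algebraMap F _ (e (Ideal.Quotient.mk _ r))) =
        algebraMap F _ (e (Ideal.Quotient.mk _ r)) := rfl
    rw [this, AlgEquiv.commutes]
    rfl

variable [W.IsElliptic]

theorem exists_uniformizer (v : Place F W.toAffine.FunctionField) :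
    ∃ t, v.IsUniformizer t ∧ ∀ f ≠ 0, ∃ n : ℤ, v.val f = v.val t ^ n := by
  by_cases h : v.val (xFun W) ≤ 1
  · obtain ⟨t, -, ht, ht'⟩ := exists_uniformizer_of_isEquiv v (isEquiv_valuation_centerPrime v h)
    exact ⟨_, ht, ht'⟩
  · exact ⟨_, isUniformizer_infinity (not_le.1 h),
      fun f hf => exists_val_eq_zpow_infinity (not_le.1 h) hf⟩

/-- A chosen uniformizer at a place of the function field. -/
noncomputable def unif (v : Place F W.toAffine.FunctionField) : W.toAffine.FunctionField :=
  (exists_uniformizer v).choose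

theorem isUniformizer_unif (v : Place F W.toAffine.FunctionField) : v.IsUniformizer (unif v) :=
  (exists_uniformizer v).choose_spec.1

theorem exists_val_eq_zpow (v : Place F W.toAffine.FunctionField) {f : W.toAffine.FunctionField}
    (hf : f ≠ 0) : ∃ n : ℤ, v.val f = v.val (unif v) ^ n :=
  (exists_uniformizer v).choose_spec.2 f hf

theorem hasOrd_iff {v : Place F W.toAffine.FunctionField} {f : W.toAffine.FunctionField} {n : ℤ} :
    v.HasOrd f n ↔ v.val f = v.val (unif v) ^ n := by
  refine ⟨fun ⟨t, ht, h⟩ => ?_, fun h => ⟨_, isUniformizer_unif v, h⟩⟩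
  rw [h, ht.val_eq (isUniformizer_unif v)]

theorem mem_riemannRochSpace {G : Place F W.toAffine.FunctionField →₀ ℤ}
    {f : W.toAffine.FunctionField} :
    f ∈ riemannRochSpace G ↔ ∀ v, v.val f ≤ v.val (unif v) ^ (-G v) :=
  ⟨fun h v => h v _ (isUniformizer_unif v), fun h v t ht => by
    rw [ht.val_eq (isUniformizer_unif v)]; exact h v⟩

theorem val_unif_infinity :
    (pointPlace W 0).val (unif (pointPlace W 0)) =
      (pointPlace W 0).val (xFun W / yFun W) :=
  (isUniformizer_unif _).val_eq (isUniformizer_infinity one_lt_val_pointPlace_zero)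

/-- Distinct affine places have distinct centres. -/
theorem eq_of_center_eq {v w : Place F W.toAffine.FunctionField} (hv : v.val (xFun W) ≤ 1)
    (hw : w.val (xFun W) ≤ 1) (h : center v hv = center w hw) : v = w := by
  apply place_ext
  ext f
  rw [← val_le_one_iff, ← val_le_one_iff,
    (isEquiv_valuation_centerPrime v hv).le_one_iff_le_one,
    (isEquiv_valuation_centerPrime w hw).le_one_iff_le_one,
    show centerPrime v hv = centerPrime w hw from HeightOneSpectrum.ext h]

/-- The residue field at a rational point is `F`. -/
theorem exists_hasValue {P : W.toAffine.Point} {f : W.toAffine.FunctionField}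
    (hf : (pointPlace W P).val f ≤ 1) : ∃ c : F, (pointPlace W P).HasValue f c := by
  rcases eq_or_ne P 0 with rfl | hP
  · exact exists_hasValue_infinity one_lt_val_pointPlace_zero hf
  have hx := val_xFun_pointPlace_le_one hP
  have hmem : ∀ r, r ∈ pointIdeal W P ↔
      (pointPlace W P).val (algebraMap _ W.toAffine.FunctionField r) < 1 := fun r => by
    rw [← center_pointPlace hP, mem_center]
  -- write `f = n / d` with `d` not vanishing at `P`
  obtain ⟨n, d, hnd⟩ := HeightOneSpectrum.exists_primeCompl_mul_eq_of_integer
    (centerPrime (pointPlace W P) hx) f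
    ((isEquiv_valuation_centerPrime _ hx).le_one_iff_le_one.1 hf)
  have hd : (pointPlace W P).val (algebraMap _ W.toAffine.FunctionField
      (d : W.toAffine.CoordinateRing)) = 1 :=
    le_antisymm (val_coordinateRing_le_one _ hx _) (not_lt.1 fun h => d.2 h)
  obtain ⟨c, hc⟩ := exists_sub_mem_pointIdeal hP n
  obtain ⟨e, he⟩ := exists_sub_mem_pointIdeal hP (d : W.toAffine.CoordinateRing)
  have he0 : e ≠ 0 := by
    rintro rfl
    rw [map_zero, sub_zero, hmem, hd] at he
    exact lt_irrefl _ he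
  refine ⟨c / e, ?_⟩
  have h1 : n - algebraMap F _ (c / e) * (d : W.toAffine.CoordinateRing) ∈ pointIdeal W P := by
    have : n - algebraMap F _ (c / e) * (d : W.toAffine.CoordinateRing) =
        (n - algebraMap F _ c) - algebraMap F _ (c / e) *
          ((d : W.toAffine.CoordinateRing) - algebraMap F _ e) := by
      rw [mul_sub, ← map_mul, div_mul_cancel₀ _ he0]
      ring
    rw [this]
    exact Ideal.sub_mem _ hc (Ideal.mul_mem_left _ _ he)
  rw [hmem, map_sub, ← hnd, map_mul, ← IsScalarTower.algebraMap_apply, ← sub_mul, map_mul, hd,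
    mul_one] at h1
  exact h1

theorem exists_unif_mem_pointIdeal {P : W.toAffine.Point} (hP : P ≠ 0) :
    ∃ r ∈ pointIdeal W P, (pointPlace W P).val (algebraMap _ W.toAffine.FunctionField r) =
      (pointPlace W P).val (unif (pointPlace W P)) := by
  obtain ⟨t, h, ht, -⟩ := exists_uniformizer_of_isEquiv _
    (isEquiv_valuation_centerPrime _ (val_xFun_pointPlace_le_one hP))
  refine ⟨t, ?_, ht.val_eq (isUniformizer_unif _)⟩
  rw [← center_pointPlace hP]
  exact h

theorem val_le_unif_of_mem_pointIdeal {P : W.toAffine.Point} (hP : P ≠ 0)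
    {r : W.toAffine.CoordinateRing} (hr : r ∈ pointIdeal W P) :
    (pointPlace W P).val (algebraMap _ W.toAffine.FunctionField r) ≤
      (pointPlace W P).val (unif (pointPlace W P)) := by
  rw [← center_pointPlace hP] at hr
  exact (isUniformizer_unif _).2 _ hr

theorem exists_mem_pointIdeal_val_eq_one {P : W.toAffine.Point}
    {v : Place F W.toAffine.FunctionField} (hx : v.val (xFun W) ≤ 1) (hv : v ≠ pointPlace W P) :
    ∃ r ∈ pointIdeal W P, v.val (algebraMap _ W.toAffine.FunctionField r) = 1 := by
  rcases eq_or_ne P 0 with rfl | hP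
  · exact ⟨1, by simp [pointIdeal_zero], by simp⟩
  by_contra! h
  apply hv
  refine eq_of_center_eq hx (val_xFun_pointPlace_le_one hP) ?_
  rw [center_pointPlace hP]
  refine ((pointIdeal_isMaximal hP).eq_of_le (center_isPrime _ _).ne_top fun r hr => ?_).symm
  exact lt_of_le_of_ne (val_coordinateRing_le_one v hx r) (h r hr)

end Points

/-! ### Products of ideals of rational points -/

section PointIdeals

variable {F : Type*} [Field F] {W : WeierstrassCurve F}

variable (W) in
/-- The equation of the vertical line through a rational point: `x - a` at the affine point
`(a, b)`, and `1` at the point at infinity. -/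
noncomputable def vertical : W.toAffine.Point → W.toAffine.CoordinateRing
  | .zero => 1
  | .some a _ _ => CoordinateRing.XClass W.toAffine a

open Classical in
/-- `1` for an affine point and `0` for the point at infinity. -/
noncomputable def affineWeight (P : W.toAffine.Point) : ℕ := if P = 0 then 0 else 1

theorem affineWeight_zero : affineWeight (0 : W.toAffine.Point) = 0 := if_pos rfl

theorem affineWeight_of_ne {P : W.toAffine.Point} (hP : P ≠ 0) : affineWeight P = 1 := if_neg hP

theorem affineWeight_neg (P : W.toAffine.Point) : affineWeight (-P) = affineWeight P := by
  rcases eq_or_ne P 0 with rfl | hP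
  · rfl
  · rw [affineWeight_of_ne hP, affineWeight_of_ne]
    intro h
    exact hP (by rw [← neg_neg P, h]; rfl)

theorem vertical_ne_zero (P : W.toAffine.Point) : vertical W P ≠ 0 := by
  match P with
  | .zero => exact one_ne_zero
  | .some a _ _ => exact CoordinateRing.XClass_ne_zero a

theorem normDegree_one : normDegree (1 : W.toAffine.CoordinateRing) = 0 := by
  rw [normDegree, map_one, natDegree_one]

theorem normDegree_vertical (P : W.toAffine.Point) :
    normDegree (vertical W P) = 2 * affineWeight P := by
  match P with
  | .zero => exact normDegree_one
  | .some a b h =>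
    rw [affineWeight_of_ne (Point.some_ne_zero h)]
    have : vertical W (.some a b h) = (X - C a) • (1 : W.toAffine.CoordinateRing) := by
      rw [CoordinateRing.smul, mul_one]
      rfl
    rw [this, normDegree_smul_one, natDegree_X_sub_C]

theorem pointIdeal_mul_neg (P : W.toAffine.Point) :
    pointIdeal W P * pointIdeal W (-P) = Ideal.span {vertical W P} := by
  match P with
  | .zero =>
    change (⊤ : Ideal _) * ⊤ = Ideal.span {1}
    rw [Ideal.span_singleton_one, Ideal.mul_top]
  | .some a b h =>
    rw [mul_comm]
    exact CoordinateRing.XYIdeal_neg_mul h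

theorem map_conj_pointIdeal_le (P : W.toAffine.Point) :
    (pointIdeal W P).map (conj W) ≤ pointIdeal W (-P) := by
  match P with
  | .zero => exact le_top
  | .some a b h =>
    rw [Point.neg_some, pointIdeal_some, pointIdeal_some, CoordinateRing.XYIdeal, Ideal.map_span,
      Ideal.span_le]
    have hX : CoordinateRing.XClass W.toAffine a ∈
        CoordinateRing.XYIdeal W.toAffine a (C (W.toAffine.negY a b)) :=
      Ideal.subset_span (Set.mem_insert _ _)
    have hY : CoordinateRing.YClass W.toAffine (C (W.toAffine.negY a b)) ∈
        CoordinateRing.XYIdeal W.toAffine a (C (W.toAffine.negY a b)) :=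
      Ideal.subset_span (Set.mem_insert_of_mem _ rfl)
    rintro _ ⟨r, rfl | rfl, rfl⟩
    · rw [CoordinateRing.XClass, conj_mk_C]
      exact hX
    · have : conj W (CoordinateRing.YClass W.toAffine (C b)) =
          -CoordinateRing.YClass W.toAffine (C (W.toAffine.negY a b)) -
            CoordinateRing.mk W.toAffine (C (C W.a₁)) * CoordinateRing.XClass W.toAffine a := by
        rw [CoordinateRing.YClass, map_sub, map_sub, conj_mk_C, conj_mk_Y, CoordinateRing.YClass,
          CoordinateRing.XClass, negY, negPolynomial, ← map_mul, ← map_sub, ← map_neg, ← map_sub]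
        congr 1
        simp only [C_sub, C_neg, C_mul, C_add]
        ring
      rw [this]
      exact Ideal.sub_mem _ (Ideal.neg_mem_iff _ |>.2 hY) (Ideal.mul_mem_left _ _ hX)

theorem conj_conj (r : W.toAffine.CoordinateRing) : conj W (conj W r) = r := by
  rcases eq_or_ne r 0 with rfl | hr
  · rw [map_zero, map_zero]
  · have hc0 : conj W r ≠ 0 := (map_ne_zero_iff _ conj_injective).2 hr
    refine mul_left_cancel₀ hc0 ?_
    rw [← algebraMap_norm, norm_conj, algebraMap_norm, mul_comm]

/-- The product of the ideals of a multiset of rational points. -/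
noncomputable def idealOf (S : Multiset W.toAffine.Point) : Ideal W.toAffine.CoordinateRing :=
  (S.map (pointIdeal W)).prod

/-- The number of affine points in a multiset of rational points. -/
noncomputable def affineCard (S : Multiset W.toAffine.Point) : ℕ := (S.map affineWeight).sum

/-- The product of the vertical lines through the points of a multiset. -/
noncomputable def verticalOf (S : Multiset W.toAffine.Point) : W.toAffine.CoordinateRing :=
  (S.map (vertical W)).prod

theorem idealOf_zero : idealOf (0 : Multiset W.toAffine.Point) = ⊤ := by
  rw [idealOf, Multiset.map_zero, Multiset.prod_zero, Ideal.one_eq_top]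

theorem idealOf_cons (P : W.toAffine.Point) (S : Multiset W.toAffine.Point) :
    idealOf (P ::ₘ S) = pointIdeal W P * idealOf S := by
  rw [idealOf, Multiset.map_cons, Multiset.prod_cons, idealOf]

theorem affineCard_cons (P : W.toAffine.Point) (S : Multiset W.toAffine.Point) :
    affineCard (P ::ₘ S) = affineWeight P + affineCard S := by
  rw [affineCard, Multiset.map_cons, Multiset.sum_cons, affineCard]

theorem affineCard_add (S T : Multiset W.toAffine.Point) :
    affineCard (S + T) = affineCard S + affineCard T := by
  rw [affineCard, Multiset.map_add, Multiset.sum_add, affineCard, affineCard]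

theorem affineCard_map_neg (S : Multiset W.toAffine.Point) :
    affineCard (S.map (- ·)) = affineCard S := by
  rw [affineCard, Multiset.map_map, affineCard]
  congr 1
  exact Multiset.map_congr rfl fun P _ => affineWeight_neg P

theorem verticalOf_cons (P : W.toAffine.Point) (S : Multiset W.toAffine.Point) :
    verticalOf (P ::ₘ S) = vertical W P * verticalOf S := by
  rw [verticalOf, Multiset.map_cons, Multiset.prod_cons, verticalOf]

theorem verticalOf_ne_zero (S : Multiset W.toAffine.Point) : verticalOf S ≠ 0 := by
  induction S using Multiset.induction_on with
  | empty => exact one_ne_zero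
  | cons P S ih => rw [verticalOf_cons]; exact mul_ne_zero (vertical_ne_zero P) ih

theorem normDegree_verticalOf (S : Multiset W.toAffine.Point) :
    normDegree (verticalOf S) = 2 * affineCard S := by
  induction S using Multiset.induction_on with
  | empty => exact normDegree_one
  | cons P S ih =>
    rw [verticalOf_cons, normDegree_mul (vertical_ne_zero P) (verticalOf_ne_zero S), ih,
      normDegree_vertical, affineCard_cons, mul_add]

theorem idealOf_mul_neg (S : Multiset W.toAffine.Point) :
    idealOf S * idealOf (S.map (- ·)) = Ideal.span {verticalOf S} := by
  induction S using Multiset.induction_on with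
  | empty =>
    change (1 : Ideal _) * 1 = Ideal.span {1}
    rw [Ideal.span_singleton_one, mul_one, Ideal.one_eq_top]
  | cons P S ih =>
    rw [Multiset.map_cons, idealOf_cons, idealOf_cons, mul_mul_mul_comm, ih, pointIdeal_mul_neg,
      Ideal.span_singleton_mul_span_singleton, verticalOf_cons]

theorem conj_mem_idealOf_neg {S : Multiset W.toAffine.Point} {r : W.toAffine.CoordinateRing}
    (hr : r ∈ idealOf S) : conj W r ∈ idealOf (S.map (- ·)) := by
  have h : (idealOf S).map (conj W) ≤ idealOf (S.map (- ·)) := by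
    clear hr
    induction S using Multiset.induction_on with
    | empty => rw [Multiset.map_zero, idealOf_zero]; exact le_top
    | cons P S ih =>
      rw [Multiset.map_cons, idealOf_cons, idealOf_cons, Ideal.map_mul]
      exact Ideal.mul_mono (map_conj_pointIdeal_le P) ih
  exact h (Ideal.mem_map_of_mem _ hr)

theorem isUnit_of_normDegree_eq_zero {r : W.toAffine.CoordinateRing} (hr : r ≠ 0)
    (h : normDegree r = 0) : IsUnit r := by
  have h1 : IsUnit (Algebra.norm F[X] r) :=
    isUnit_iff_degree_eq_zero.2 ((degree_eq_iff_natDegree_eq (norm_ne_zero hr)).2 h)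
  have h2 := h1.map (algebraMap F[X] W.toAffine.CoordinateRing)
  rw [algebraMap_norm] at h2
  exact isUnit_of_mul_isUnit_left h2

/-- A regular function vanishing at a multiset of points whose norm degree does not exceed the
number of these points has no other zero: comparing with the conjugate function shows that it
generates the product of the ideals of the points. -/
theorem span_eq_idealOf {S : Multiset W.toAffine.Point} {r : W.toAffine.CoordinateRing}
    (hr0 : r ≠ 0) (hr : r ∈ idealOf S) (hdeg : normDegree r ≤ affineCard S) :
    Ideal.span {r} = idealOf S := by
  have hc0 : conj W r ≠ 0 := (map_ne_zero_iff _ conj_injective).2 hr0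
  have h1 : r * conj W r ∈ Ideal.span {verticalOf S} := by
    rw [← idealOf_mul_neg]
    exact Ideal.mul_mem_mul hr (conj_mem_idealOf_neg hr)
  obtain ⟨s, hs⟩ := Ideal.mem_span_singleton'.1 h1
  have hs0 : s ≠ 0 := by
    rintro rfl
    rw [zero_mul] at hs
    exact mul_ne_zero hr0 hc0 hs.symm
  have hsdeg : normDegree s = 0 := by
    have h2 := congrArg normDegree hs
    rw [normDegree_mul hs0 (verticalOf_ne_zero S), normDegree_mul hr0 hc0, normDegree_verticalOf,
      normDegree_conj] at h2
    omega
  have hspan : Ideal.span {verticalOf S} = Ideal.span {r * conj W r} := by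
    rw [← hs, Ideal.span_singleton_mul_left_unit (isUnit_of_normDegree_eq_zero hs0 hsdeg)]
  refine le_antisymm ((Ideal.span_singleton_le_iff_mem _).2 hr) fun a ha => ?_
  have h3 : a * conj W r ∈ Ideal.span {r * conj W r} := by
    rw [← hspan, ← idealOf_mul_neg]
    exact Ideal.mul_mem_mul ha (conj_mem_idealOf_neg hr)
  obtain ⟨b, hb⟩ := Ideal.mem_span_singleton'.1 h3
  rw [Ideal.mem_span_singleton']
  exact ⟨b, mul_right_cancel₀ hc0 (by rw [← hb, mul_assoc])⟩

/-- The norm degree counts the affine zeros of a function all of whose affine zeros are rational. -/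
theorem normDegree_of_span_eq {S : Multiset W.toAffine.Point} {r : W.toAffine.CoordinateRing}
    (hr0 : r ≠ 0) (hr : Ideal.span {r} = idealOf S) : normDegree r = affineCard S := by
  have hc0 : conj W r ≠ 0 := (map_ne_zero_iff _ conj_injective).2 hr0
  have hconj : Ideal.span {conj W r} = idealOf (S.map (- ·)) := by
    refine le_antisymm ((Ideal.span_singleton_le_iff_mem _).2 (conj_mem_idealOf_neg
      (hr ▸ Ideal.mem_span_singleton_self r))) fun a ha => ?_
    have h1 := conj_mem_idealOf_neg ha
    rw [Multiset.map_map, Function.Involutive.comp_self (neg_involutive (G := W.toAffine.Point)),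
      Multiset.map_id, ← hr] at h1
    obtain ⟨b, hb⟩ := Ideal.mem_span_singleton'.1 h1
    rw [Ideal.mem_span_singleton']
    exact ⟨conj W b, by rw [← map_mul, hb, conj_conj]⟩
  have h := idealOf_mul_neg S
  rw [← hr, ← hconj, Ideal.span_singleton_mul_span_singleton,
    Ideal.span_singleton_eq_span_singleton] at h
  obtain ⟨u, hu⟩ := h
  have hu0 : normDegree (u : W.toAffine.CoordinateRing) = 0 := by
    have h1 := congrArg normDegree u.mul_inv
    rw [normDegree_mul u.ne_zero (u⁻¹).ne_zero, normDegree_one] at h1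
    omega
  have h2 := congrArg normDegree hu
  rw [normDegree_mul (mul_ne_zero hr0 hc0) u.ne_zero, normDegree_mul hr0 hc0, hu0, normDegree_conj,
    normDegree_verticalOf] at h2
  omega

end PointIdeals

/-! ### Principal ideals and sums of points -/

section PointUnits

variable {F : Type*} [Field F] {W : WeierstrassCurve F}

/-- The ideal of a rational point as an invertible fractional ideal. -/
noncomputable def pointUnit : W.toAffine.Point →
    (FractionalIdeal W.toAffine.CoordinateRing⁰ W.toAffine.FunctionField)ˣ
  | .zero => 1
  | .some _ _ h => CoordinateRing.XYIdeal' (W := W.toAffine) h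

theorem coe_pointUnit (P : W.toAffine.Point) :
    (pointUnit P : FractionalIdeal W.toAffine.CoordinateRing⁰ W.toAffine.FunctionField) =
      (pointIdeal W P : FractionalIdeal _ _) := by
  match P with
  | .zero => exact (FractionalIdeal.coeIdeal_top _).symm
  | .some _ _ h => rfl

theorem mk_pointUnit [DecidableEq F] (P : W.toAffine.Point) :
    ClassGroup.mk W.toAffine.FunctionField (pointUnit P) = (Point.toClass P).toMul := by
  match P with
  | .zero => exact map_one _
  | .some _ _ h => rfl

/-- The product of the ideals of a multiset of rational points, as an invertible fractional ideal;
its class in the class group corresponds to the sum of the points. -/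
noncomputable def unitOf (S : Multiset W.toAffine.Point) :
    (FractionalIdeal W.toAffine.CoordinateRing⁰ W.toAffine.FunctionField)ˣ :=
  (S.map pointUnit).prod

theorem unitOf_zero : unitOf (0 : Multiset W.toAffine.Point) = 1 := by
  rw [unitOf, Multiset.map_zero, Multiset.prod_zero]

theorem unitOf_cons (P : W.toAffine.Point) (S : Multiset W.toAffine.Point) :
    unitOf (P ::ₘ S) = pointUnit P * unitOf S := by
  rw [unitOf, Multiset.map_cons, Multiset.prod_cons, unitOf]

theorem unitOf_add (S T : Multiset W.toAffine.Point) :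
    unitOf (S + T) = unitOf S * unitOf T := by
  rw [unitOf, Multiset.map_add, Multiset.prod_add, unitOf, unitOf]

theorem coe_unitOf (S : Multiset W.toAffine.Point) :
    (unitOf S : FractionalIdeal W.toAffine.CoordinateRing⁰ W.toAffine.FunctionField) =
      (idealOf S : FractionalIdeal _ _) := by
  induction S using Multiset.induction_on with
  | empty => rw [unitOf_zero, idealOf_zero, Units.val_one, FractionalIdeal.coeIdeal_top]
  | cons P S ih =>
    rw [unitOf_cons, idealOf_cons, Units.val_mul, ih, coe_pointUnit, FractionalIdeal.coeIdeal_mul]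

theorem mk_unitOf [DecidableEq F] (S : Multiset W.toAffine.Point) :
    ClassGroup.mk W.toAffine.FunctionField (unitOf S) = (Point.toClass S.sum).toMul := by
  induction S using Multiset.induction_on with
  | empty => exact map_one _
  | cons P S ih =>
    rw [unitOf_cons, map_mul, ih, mk_pointUnit, Multiset.sum_cons, map_add, toMul_add]

/-- A product of ideals of points is principal if and only if the points add up to zero. -/
theorem exists_span_eq_idealOf_iff [DecidableEq F] {S : Multiset W.toAffine.Point} :
    (∃ r, r ≠ 0 ∧ idealOf S = Ideal.span {r}) ↔ S.sum = 0 := by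
  rw [← ClassGroup.mk_eq_one_of_coe_ideal (coe_unitOf S), mk_unitOf, toMul_eq_one,
    Point.toClass_eq_zero]

end PointUnits

/-! ### Functions with a prescribed divisor of degree zero -/

section Divisors

variable {F : Type*} [Field F] {W : WeierstrassCurve F}

/-- The divisor `∑ P` attached to a multiset of rational points `P`. -/
noncomputable def divisorOf (S : Multiset W.toAffine.Point) :
    Place F W.toAffine.FunctionField →₀ ℤ :=
  (S.map fun P => Finsupp.single (pointPlace W P) (1 : ℤ)).sum

theorem divisorOf_zero : divisorOf (0 : Multiset W.toAffine.Point) = 0 := by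
  rw [divisorOf, Multiset.map_zero, Multiset.sum_zero]

theorem divisorOf_cons (P : W.toAffine.Point) (S : Multiset W.toAffine.Point) :
    divisorOf (P ::ₘ S) = Finsupp.single (pointPlace W P) 1 + divisorOf S := by
  rw [divisorOf, Multiset.map_cons, Multiset.sum_cons, divisorOf]

theorem divisorOf_replicate (n : ℕ) (Q : W.toAffine.Point) :
    divisorOf (Multiset.replicate n Q) = Finsupp.single (pointPlace W Q) (n : ℤ) := by
  rw [divisorOf, Multiset.map_replicate, Multiset.sum_replicate, Finsupp.smul_single, nsmul_one]

theorem divisorOf_apply_infinity (S : Multiset W.toAffine.Point) :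
    divisorOf S (pointPlace W 0) = (Multiset.card S : ℤ) - affineCard S := by
  induction S using Multiset.induction_on with
  | empty => simp [divisorOf_zero, affineCard]
  | cons P S ih =>
    rw [divisorOf_cons, Finsupp.add_apply, ih, affineCard_cons, Multiset.card_cons]
    rcases eq_or_ne P 0 with rfl | hP
    · rw [Finsupp.single_eq_same, affineWeight_zero]
      push_cast
      ring
    · rw [Finsupp.single_eq_of_ne (fun h => hP (pointPlace_injective h.symm)),
        affineWeight_of_ne hP]
      push_cast
      ring

theorem divisorOf_apply_of_notMem {S : Multiset W.toAffine.Point}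
    {v : Place F W.toAffine.FunctionField} (h : ∀ P ∈ S, v ≠ pointPlace W P) :
    divisorOf S v = 0 := by
  induction S using Multiset.induction_on with
  | empty => simp [divisorOf_zero]
  | cons P S ih =>
    rw [divisorOf_cons, Finsupp.add_apply, ih fun Q hQ => h Q (Multiset.mem_cons_of_mem hQ),
      Finsupp.single_eq_of_ne (h P (Multiset.mem_cons_self P S)), add_zero]

theorem divisorOf_apply_of_nodup {S : Multiset W.toAffine.Point} (hS : S.Nodup)
    {P : W.toAffine.Point} (hP : P ∈ S) : divisorOf S (pointPlace W P) = 1 := by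
  obtain ⟨T, rfl⟩ := Multiset.exists_cons_of_mem hP
  rw [divisorOf_cons, Finsupp.add_apply, Finsupp.single_eq_same, divisorOf_apply_of_notMem,
    add_zero]
  intro Q hQ h
  rw [← pointPlace_injective h] at hQ
  exact (Multiset.nodup_cons.1 hS).1 hQ

variable [W.IsElliptic]

theorem zpow_unif_add (v : Place F W.toAffine.FunctionField) (m n : ℤ) :
    v.val (unif v) ^ (m + n) = v.val (unif v) ^ m * v.val (unif v) ^ n :=
  zpow_add₀ (isUniformizer_unif v).val_pos.ne' m n

/-- Order bounds for two fractional ideals give an order bound for their product. -/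
theorem val_le_of_mem_mul {v : Place F W.toAffine.FunctionField} {m n : ℤ}
    {I J : FractionalIdeal W.toAffine.CoordinateRing⁰ W.toAffine.FunctionField}
    (hI : ∀ f ∈ I, v.val f ≤ v.val (unif v) ^ m) (hJ : ∀ f ∈ J, v.val f ≤ v.val (unif v) ^ n)
    {f : W.toAffine.FunctionField} (hf : f ∈ I * J) : v.val f ≤ v.val (unif v) ^ (m + n) := by
  refine FractionalIdeal.mul_induction_on hf (fun i hi j hj => ?_) fun a b ha hb => ?_
  · rw [map_mul, zpow_unif_add]
    exact mul_le_mul' (hI i hi) (hJ j hj)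
  · exact (v.val.map_add _ _).trans (max_le ha hb)

theorem val_le_of_mem_pointUnit {v : Place F W.toAffine.FunctionField} (hx : v.val (xFun W) ≤ 1)
    {P : W.toAffine.Point} {f : W.toAffine.FunctionField}
    (hf : f ∈ (pointUnit P : FractionalIdeal W.toAffine.CoordinateRing⁰ W.toAffine.FunctionField)) :
    v.val f ≤ v.val (unif v) ^ (Finsupp.single (pointPlace W P) (1 : ℤ) v) := by
  rw [coe_pointUnit, FractionalIdeal.mem_coeIdeal] at hf
  obtain ⟨r, hr, rfl⟩ := hf
  rcases eq_or_ne v (pointPlace W P) with rfl | hv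
  · have hP : P ≠ 0 := by
      rintro rfl
      exact absurd hx (not_le.2 one_lt_val_pointPlace_zero)
    rw [Finsupp.single_eq_same, zpow_one]
    exact val_le_unif_of_mem_pointIdeal hP hr
  · rw [Finsupp.single_eq_of_ne hv, zpow_zero]
    exact val_coordinateRing_le_one v hx r

theorem val_le_of_mem_pointUnit_inv {v : Place F W.toAffine.FunctionField}
    (hx : v.val (xFun W) ≤ 1) {P : W.toAffine.Point} {f : W.toAffine.FunctionField}
    (hf : f ∈ ((pointUnit P)⁻¹ :
      (FractionalIdeal W.toAffine.CoordinateRing⁰ W.toAffine.FunctionField)ˣ).val) :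
    v.val f ≤ v.val (unif v) ^ (-Finsupp.single (pointPlace W P) (1 : ℤ) v) := by
  -- multiply by a function in the ideal of `P` with the smallest possible order at `v`
  obtain ⟨r, hr, hv⟩ : ∃ r ∈ pointIdeal W P, v.val (algebraMap _ W.toAffine.FunctionField r) =
      v.val (unif v) ^ (Finsupp.single (pointPlace W P) (1 : ℤ) v) := by
    rcases eq_or_ne v (pointPlace W P) with rfl | hv
    · have hP : P ≠ 0 := by
        rintro rfl
        exact absurd hx (not_le.2 one_lt_val_pointPlace_zero)
      rw [Finsupp.single_eq_same, zpow_one]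
      exact exists_unif_mem_pointIdeal hP
    · rw [Finsupp.single_eq_of_ne hv, zpow_zero]
      exact exists_mem_pointIdeal_val_eq_one hx hv
  have hmem : f * algebraMap _ _ r ∈
      (1 : FractionalIdeal W.toAffine.CoordinateRing⁰ W.toAffine.FunctionField) := by
    rw [← Units.val_one, ← inv_mul_cancel (pointUnit P), Units.val_mul]
    refine FractionalIdeal.mul_mem_mul hf ?_
    rw [coe_pointUnit, FractionalIdeal.mem_coeIdeal]
    exact ⟨r, hr, rfl⟩
  obtain ⟨s, hs⟩ := (FractionalIdeal.mem_one_iff _).1 hmem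
  have h1 := val_coordinateRing_le_one v hx s
  rw [hs, map_mul, hv] at h1
  rwa [zpow_neg, ← one_div, le_div_iff₀ (zpow_pos (isUniformizer_unif v).val_pos _)]

theorem val_le_of_mem_unitOf {v : Place F W.toAffine.FunctionField} (hx : v.val (xFun W) ≤ 1)
    {S : Multiset W.toAffine.Point} {f : W.toAffine.FunctionField}
    (hf : f ∈ (unitOf S : FractionalIdeal W.toAffine.CoordinateRing⁰ W.toAffine.FunctionField)) :
    v.val f ≤ v.val (unif v) ^ (divisorOf S v) := by
  induction S using Multiset.induction_on generalizing f with
  | empty =>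
    rw [unitOf_zero, Units.val_one, FractionalIdeal.mem_one_iff] at hf
    obtain ⟨r, rfl⟩ := hf
    rw [divisorOf_zero, Finsupp.zero_apply, zpow_zero]
    exact val_coordinateRing_le_one v hx r
  | cons P S ih =>
    rw [unitOf_cons, Units.val_mul] at hf
    rw [divisorOf_cons, Finsupp.add_apply]
    exact val_le_of_mem_mul (fun f hf => val_le_of_mem_pointUnit hx hf) (fun f hf => ih hf) hf

theorem val_le_of_mem_unitOf_inv {v : Place F W.toAffine.FunctionField}
    (hx : v.val (xFun W) ≤ 1) {S : Multiset W.toAffine.Point} {f : W.toAffine.FunctionField}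
    (hf : f ∈ ((unitOf S)⁻¹ :
      (FractionalIdeal W.toAffine.CoordinateRing⁰ W.toAffine.FunctionField)ˣ).val) :
    v.val f ≤ v.val (unif v) ^ (-divisorOf S v) := by
  induction S using Multiset.induction_on generalizing f with
  | empty =>
    rw [unitOf_zero, inv_one, Units.val_one, FractionalIdeal.mem_one_iff] at hf
    obtain ⟨r, rfl⟩ := hf
    rw [divisorOf_zero, Finsupp.zero_apply, neg_zero, zpow_zero]
    exact val_coordinateRing_le_one v hx r
  | cons P S ih =>
    rw [unitOf_cons, mul_inv, Units.val_mul] at hf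
    rw [divisorOf_cons, Finsupp.add_apply, neg_add]
    exact val_le_of_mem_mul (fun f hf => val_le_of_mem_pointUnit_inv hx hf) (fun f hf => ih hf) hf

/-- Conversely to the two previous bounds, the order conditions at the affine places characterize
membership in a product of powers of ideals of points. -/
theorem mem_unitOf_mul_inv {S T : Multiset W.toAffine.Point} {f : W.toAffine.FunctionField}
    (hf : ∀ v : Place F W.toAffine.FunctionField, v.val (xFun W) ≤ 1 →
      v.val f ≤ v.val (unif v) ^ (divisorOf S v - divisorOf T v)) :
    f ∈ (unitOf S * (unitOf T)⁻¹ :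
      (FractionalIdeal W.toAffine.CoordinateRing⁰ W.toAffine.FunctionField)ˣ).val := by
  set U := unitOf S * (unitOf T)⁻¹ with hU
  have hUinv : U⁻¹ = (unitOf S)⁻¹ * unitOf T := by rw [hU, mul_inv, inv_inv]
  have h1 : FractionalIdeal.spanSingleton W.toAffine.CoordinateRing⁰ f * (U⁻¹).val ≤ 1 := by
    rw [FractionalIdeal.mul_le]
    intro g hg j hj
    rw [FractionalIdeal.mem_one_iff]
    apply exists_eq_algebraMap_of_val_le_one (F := F)
    intro v hx
    obtain ⟨z, rfl⟩ := (FractionalIdeal.mem_spanSingleton _).1 hg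
    rw [hUinv, Units.val_mul] at hj
    have hj' := val_le_of_mem_mul (fun f hf => val_le_of_mem_unitOf_inv hx hf)
      (fun f hf => val_le_of_mem_unitOf hx hf) hj
    have h2 := mul_le_mul' (hf v hx) hj'
    rw [← zpow_unif_add, show divisorOf S v - divisorOf T v + (-divisorOf S v + divisorOf T v) = 0
      by ring, zpow_zero, ← map_mul] at h2
    rw [Algebra.smul_def, mul_assoc, map_mul]
    exact mul_le_one' (val_coordinateRing_le_one v hx z) h2
  have h2 := mul_le_mul_left h1 U.val
  rw [mul_assoc, Units.inv_mul, mul_one, one_mul] at h2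
  exact FractionalIdeal.spanSingleton_le_iff_mem.1 h2

/-- If `f` has divisor at least `S - T`, where `S` and `T` have the same number of points, then the
divisor of `f` is `S - T`, and this forces `S` and `T` to have the same sum in the group of rational
points. -/
theorem sum_eq_of_val_le [DecidableEq F] {S T : Multiset W.toAffine.Point}
    (hcard : Multiset.card S = Multiset.card T) {f : W.toAffine.FunctionField} (hf0 : f ≠ 0)
    (hf : ∀ v, v.val f ≤ v.val (unif v) ^ (divisorOf S v - divisorOf T v)) : S.sum = T.sum := by
  set T' := T.map (- ·) with hT'
  -- clear the poles of `f` by vertical lines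
  have hmem : f * algebraMap _ _ (verticalOf T) ∈
      (idealOf (S + T') : FractionalIdeal W.toAffine.CoordinateRing⁰ W.toAffine.FunctionField) := by
    have h1 : algebraMap _ _ (verticalOf T) ∈ (unitOf T * unitOf T' :
        (FractionalIdeal W.toAffine.CoordinateRing⁰ W.toAffine.FunctionField)ˣ).val := by
      rw [Units.val_mul, coe_unitOf, coe_unitOf, ← FractionalIdeal.coeIdeal_mul, idealOf_mul_neg,
        FractionalIdeal.mem_coeIdeal]
      exact ⟨_, Ideal.mem_span_singleton_self _, rfl⟩
    have h2 := FractionalIdeal.mul_mem_mul (mem_unitOf_mul_inv fun v _ => hf v) h1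
    rw [← Units.val_mul, mul_assoc, inv_mul_cancel_left, ← unitOf_add, coe_unitOf] at h2
    exact h2
  obtain ⟨r, hr, hrf⟩ := (FractionalIdeal.mem_coeIdeal _).1 hmem
  have hvK : algebraMap _ W.toAffine.FunctionField (verticalOf T) ≠ 0 :=
    (map_ne_zero_iff _ (IsFractionRing.injective _ _)).2 (verticalOf_ne_zero T)
  have hr0 : r ≠ 0 := by
    rintro rfl
    rw [map_zero] at hrf
    exact mul_ne_zero hf0 hvK hrf.symm
  have hdeg : normDegree r ≤ affineCard (S + T') := by
    have h1 := congrArg (pointPlace W 0).val hrf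
    have h2 := hf (pointPlace W 0)
    rw [map_mul, val_infinity one_lt_val_pointPlace_zero hr0,
      val_infinity one_lt_val_pointPlace_zero (verticalOf_ne_zero T), ← val_unif_infinity] at h1
    have h3 := mul_le_mul_left h2 ((pointPlace W 0).val (unif (pointPlace W 0)) ^
      (-(normDegree (verticalOf T) : ℤ)))
    rw [← h1, ← zpow_unif_add, (isUniformizer_unif _).zpow_le_iff, divisorOf_apply_infinity,
      divisorOf_apply_infinity, normDegree_verticalOf, hcard] at h3
    rw [affineCard_add, affineCard_map_neg]
    push_cast at h3
    omega
  have h := exists_span_eq_idealOf_iff.1 ⟨r, hr0, (span_eq_idealOf hr0 hr hdeg).symm⟩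
  rw [Multiset.sum_add, Multiset.sum_map_neg, ← sub_eq_add_neg, sub_eq_zero, Multiset.map_id'] at h
  exact h

end Divisors

/-! ### The lower bound for the dimension of a Riemann-Roch space -/

section LowerBound

variable {F : Type*} [Field F] {W : WeierstrassCurve F}

theorem normDegree_smul (p : F[X]) (hp : p ≠ 0) {r : W.toAffine.CoordinateRing} (hr : r ≠ 0) :
    normDegree (p • r) = 2 * p.natDegree + normDegree r := by
  have h : p • r = (p • (1 : W.toAffine.CoordinateRing)) * r := by rw [smul_mul_assoc, one_mul]
  have hp1 : p • (1 : W.toAffine.CoordinateRing) ≠ 0 := by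
    intro h0
    exact hp ((smul_eq_zero.1 h0).resolve_right one_ne_zero)
  rw [h, normDegree_mul hp1 hr, normDegree_smul_one]

theorem normDegree_YClass (b : F) : normDegree (CoordinateRing.YClass W.toAffine (C b)) = 3 := by
  have : CoordinateRing.YClass W.toAffine (C b) =
      (C (-b)) • (1 : W.toAffine.CoordinateRing) + (1 : F[X]) • CoordinateRing.mk W.toAffine X := by
    rw [CoordinateRing.smul, CoordinateRing.smul, mul_one, C_1, map_one, one_mul,
      CoordinateRing.YClass, map_sub, C_neg, C_neg, map_neg]
    ring
  rw [this, normDegree_smul_basis _ one_ne_zero]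
  simp

theorem normDegree_XClass (a : F) : normDegree (CoordinateRing.XClass W.toAffine a) = 2 := by
  have : CoordinateRing.XClass W.toAffine a = (X - C a) • (1 : W.toAffine.CoordinateRing) := by
    rw [CoordinateRing.smul, mul_one]
    rfl
  rw [this, normDegree_smul_one, natDegree_X_sub_C]

/-- Every pole order at least `2` at infinity is attained by a regular function which vanishes at a
given point: take `(x - a) x ^ i` and `(y - b) x ^ i`. -/
theorem exists_mem_pointIdeal_normDegree_eq (P : W.toAffine.Point) {d : ℕ} (hd : 2 ≤ d) :
    ∃ r ∈ pointIdeal W P, r ≠ 0 ∧ normDegree r = d := by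
  obtain ⟨a, b, hX, hY⟩ : ∃ a b, CoordinateRing.XClass W.toAffine a ∈ pointIdeal W P ∧
      CoordinateRing.YClass W.toAffine (C b) ∈ pointIdeal W P := by
    match P with
    | .zero => exact ⟨0, 0, Submodule.mem_top, Submodule.mem_top⟩
    | .some a b h =>
      exact ⟨a, b, Ideal.subset_span (Set.mem_insert _ _),
        Ideal.subset_span (Set.mem_insert_of_mem _ rfl)⟩
  have hpow : ∀ n, (X ^ n : F[X]) ≠ 0 := fun n => pow_ne_zero n X_ne_zero
  have hsmul : ∀ (n : ℕ) {r : W.toAffine.CoordinateRing}, r ∈ pointIdeal W P →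
      (X ^ n : F[X]) • r ∈ pointIdeal W P := fun n r hr => by
    rw [Algebra.smul_def]
    exact Ideal.mul_mem_left _ _ hr
  rcases Nat.even_or_odd' d with ⟨m, rfl | rfl⟩
  · refine ⟨(X ^ (m - 1) : F[X]) • CoordinateRing.XClass W.toAffine a, hsmul _ hX,
      smul_ne_zero (hpow _) (CoordinateRing.XClass_ne_zero a), ?_⟩
    rw [normDegree_smul _ (hpow _) (CoordinateRing.XClass_ne_zero a), natDegree_X_pow,
      normDegree_XClass]
    omega
  · refine ⟨(X ^ (m - 1) : F[X]) • CoordinateRing.YClass W.toAffine (C b), hsmul _ hY,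
      smul_ne_zero (hpow _) (CoordinateRing.YClass_ne_zero _), ?_⟩
    rw [normDegree_smul _ (hpow _) (CoordinateRing.YClass_ne_zero _), natDegree_X_pow,
      normDegree_YClass]
    omega

/-- In the ideal of a point there are `k` functions with distinct pole orders at infinity, the
largest one being at most `k` (if the point is at infinity) or `k + 1` (otherwise). -/
theorem exists_family_mem_pointIdeal (P : W.toAffine.Point) (k : ℕ) :
    ∃ a : Fin k → W.toAffine.CoordinateRing, (∀ j, a j ∈ pointIdeal W P) ∧ (∀ j, a j ≠ 0) ∧
      (∀ j, normDegree (a j) ≤ k + affineWeight P) ∧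
      Function.Injective fun j => normDegree (a j) := by
  rcases eq_or_ne P 0 with rfl | hP
  · have h : ∀ j : Fin k, ∃ r : W.toAffine.CoordinateRing, r ≠ 0 ∧
        normDegree r = if (j : ℕ) = 0 then 0 else (j : ℕ) + 1 := fun j => by
      split_ifs with hj
      · exact ⟨1, one_ne_zero, normDegree_one⟩
      · obtain ⟨r, -, hr⟩ := exists_mem_pointIdeal_normDegree_eq (W := W) 0
          (show 2 ≤ (j : ℕ) + 1 by omega)
        exact ⟨r, hr⟩
    choose a ha0 ha using h
    refine ⟨a, fun j => Submodule.mem_top, ha0, fun j => ?_, fun i j hij => Fin.ext ?_⟩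
    · rw [ha]
      split_ifs <;> omega
    · simp only [ha] at hij
      split_ifs at hij <;> omega
  · have h : ∀ j : Fin k, ∃ r ∈ pointIdeal W P, r ≠ 0 ∧ normDegree r = j + 2 := fun j =>
      exists_mem_pointIdeal_normDegree_eq P (by omega)
    choose a hmem ha0 ha using h
    refine ⟨a, hmem, ha0, fun j => ?_, fun i j hij => Fin.ext ?_⟩
    · rw [ha, affineWeight_of_ne hP]
      omega
    · simp only [ha] at hij
      omega

/-- Functions with distinct valuations are linearly independent over the constants. -/
theorem linearIndependent_of_val_injective {K ι : Type*} [Field K] [Algebra F K] [Fintype ι]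
    (v : Place F K) {f : ι → K} (hf0 : ∀ i, f i ≠ 0)
    (hf : Function.Injective fun i => v.val (f i)) : LinearIndependent F f := by
  classical
  rw [Fintype.linearIndependent_iff]
  intro c hc
  by_contra! h
  obtain ⟨i₀, hi₀⟩ := h
  obtain ⟨i, hi, hmax⟩ := (Finset.univ.filter fun i => c i ≠ 0).exists_max_image
    (fun i => v.val (f i)) ⟨i₀, by simpa using hi₀⟩
  have hci : c i ≠ 0 := (Finset.mem_filter.1 hi).2
  have hval : ∀ j, c j ≠ 0 → v.val (c j • f j) = v.val (f j) := fun j hj => by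
    rw [Algebra.smul_def, map_mul, val_algebraMap v hj, one_mul]
  rw [← Finset.add_sum_erase _ _ (Finset.mem_univ i)] at hc
  have hlt : v.val (∑ j ∈ Finset.univ.erase i, c j • f j) < v.val (f i) := by
    refine v.val.map_sum_lt (v.val.ne_zero_iff.2 (hf0 i)) fun j hj => ?_
    rcases eq_or_ne (c j) 0 with h0 | h0
    · rw [h0, zero_smul, map_zero]
      exact (Valuation.pos_iff _).2 (hf0 i)
    · rw [hval j h0]
      refine lt_of_le_of_ne (hmax j (by simpa using h0)) fun h => ?_
      exact (Finset.mem_erase.1 hj).1 (hf h)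
  have h1 := congrArg v.val hc
  rw [Valuation.map_add_eq_of_lt_left _ (by rwa [hval i hci]), hval i hci, map_zero,
    map_eq_zero] at h1
  exact hf0 i h1

variable [W.IsElliptic] [DecidableEq F]

/-- The lower bound of the Riemann-Roch theorem: `L(T)` contains at least `deg T` linearly
independent functions if `T` is a sum of rational points. If `S` is the sum of the points
of `T` in the group, then the ideal of the points of `T` and of `-S` is generated by a function `r`,
and the quotients `a / r`, with `a` vanishing at `-S`, have no poles outside `T`. -/
theorem exists_linearIndependent (T : Multiset W.toAffine.Point) :
    ∃ f : Fin (Multiset.card T) → W.toAffine.FunctionField, LinearIndependent F f ∧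
      ∀ j, f j ∈ riemannRochSpace (divisorOf T) := by
  obtain ⟨r, hr0, hr⟩ := exists_span_eq_idealOf_iff.2
    (show (-T.sum ::ₘ T).sum = 0 by rw [Multiset.sum_cons, neg_add_cancel])
  have hrdeg := normDegree_of_span_eq hr0 hr.symm
  rw [affineCard_cons] at hrdeg
  obtain ⟨a, ha, ha0, hdeg, hinj⟩ := exists_family_mem_pointIdeal (-T.sum) (Multiset.card T)
  have hinf := one_lt_val_pointPlace_zero (W := W)
  refine ⟨fun j => algebraMap _ _ (a j) / algebraMap _ _ r,
    linearIndependent_of_val_injective (pointPlace W 0) (fun j => ?_) fun i j hij => hinj ?_,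
    fun j => ?_⟩
  · exact div_ne_zero ((map_ne_zero_iff _ (IsFractionRing.injective _ _)).2 (ha0 j))
      ((map_ne_zero_iff _ (IsFractionRing.injective _ _)).2 hr0)
  · simp only [val_div_infinity hinf (ha0 _) hr0] at hij
    have h1 := (zpow_le_zpow_iff_infinity hinf).1 hij.le
    have h2 := (zpow_le_zpow_iff_infinity hinf).1 hij.ge
    simp only
    omega
  · rw [mem_riemannRochSpace]
    intro v
    by_cases hx : v.val (xFun W) ≤ 1
    · have h1 : algebraMap _ W.toAffine.FunctionField (a j) ∈ (unitOf {-T.sum} :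
          FractionalIdeal W.toAffine.CoordinateRing⁰ W.toAffine.FunctionField) := by
        rw [coe_unitOf, FractionalIdeal.mem_coeIdeal]
        refine ⟨_, ?_, rfl⟩
        rw [← Multiset.cons_zero, idealOf_cons, idealOf_zero, Ideal.mul_top]
        exact ha j
      have h2 : (algebraMap _ W.toAffine.FunctionField r)⁻¹ ∈ ((unitOf (-T.sum ::ₘ T))⁻¹ :
          (FractionalIdeal W.toAffine.CoordinateRing⁰ W.toAffine.FunctionField)ˣ).val := by
        have h3 : ((unitOf (-T.sum ::ₘ T))⁻¹ :
          (FractionalIdeal W.toAffine.CoordinateRing⁰ W.toAffine.FunctionField)ˣ).val =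
            FractionalIdeal.spanSingleton _ (algebraMap _ W.toAffine.FunctionField r)⁻¹ := by
          rw [← Units.mul_eq_one_iff_inv_eq, coe_unitOf, hr,
            FractionalIdeal.coeIdeal_span_singleton,
            FractionalIdeal.spanSingleton_mul_spanSingleton, mul_inv_cancel₀,
            FractionalIdeal.spanSingleton_one]
          exact (map_ne_zero_iff _ (IsFractionRing.injective _ _)).2 hr0
        rw [h3]
        exact FractionalIdeal.mem_spanSingleton_self _ _
      have h3 := val_le_of_mem_mul (fun f hf => val_le_of_mem_unitOf hx hf)
        (fun f hf => val_le_of_mem_unitOf_inv hx hf) (FractionalIdeal.mul_mem_mul h1 h2)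
      rw [divisorOf_cons, ← Multiset.cons_zero, divisorOf_cons, divisorOf_zero, add_zero,
        Finsupp.add_apply, neg_add, add_neg_cancel_left, ← div_eq_mul_inv] at h3
      exact h3
    · obtain rfl := eq_pointPlace_zero hx
      rw [val_div_infinity hinf (ha0 j) hr0, ← val_unif_infinity,
        (isUniformizer_unif _).zpow_le_iff, divisorOf_apply_infinity]
      have := hdeg j
      omega

end LowerBound

/-! ### A criterion for MDS codes -/

section MDS

variable {F ι : Type*} [Field F] [Finite ι]

open Classical in
/-- A `k`-dimensional code in which only the zero word vanishes at `k` coordinates is an MDS code: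
the Singleton bound provides a word of weight `n - k + 1`. -/
theorem hasParameters_of_eq_zero {C : Submodule F (ι → F)} {n k : ℕ} (hn : Nat.card ι = n)
    (hk : 1 ≤ k) (hkn : k ≤ n) (hdim : Module.finrank F C = k)
    (hz : ∀ c ∈ C, ∀ Z : Finset ι, Z.card = k → (∀ i ∈ Z, c i = 0) → c = 0) :
    HasParameters C n k (n - k + 1) := by
  let _ : Fintype ι := Fintype.ofFinite ι
  have hn' : Fintype.card ι = n := by rw [← Nat.card_eq_fintype_card, hn]
  have hdist : ∀ x y : ι → F, hammingDist x y +
      (Finset.univ.filter fun i => (x - y) i = 0).card = n := fun x y => by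
    have h := Finset.card_filter_add_card_filter_not (s := Finset.univ) (fun i => x i = y i)
    rw [Finset.card_univ, hn', add_comm] at h
    have e : (Finset.univ.filter fun i => (x - y) i = 0) =
        Finset.univ.filter fun i => x i = y i :=
      Finset.filter_congr fun i _ => by rw [Pi.sub_apply, sub_eq_zero]
    rw [e]
    exact h
  have hlt : ∀ c ∈ C, c ≠ 0 → (Finset.univ.filter fun i => c i = 0).card < k := fun c hc h0 => by
    by_contra! h
    obtain ⟨Z, hZ, hZk⟩ := Finset.exists_subset_card_eq h
    exact h0 (hz c hc Z hZk fun i hi => (Finset.mem_filter.1 (hZ hi)).2)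
  refine ⟨hn', hdim, ?_, ?_⟩
  · obtain ⟨A, -, hA⟩ := Finset.exists_subset_card_eq (s := (Finset.univ : Finset ι)) (n := k - 1)
      (by rw [Finset.card_univ, hn']; omega)
    let φ : C →ₗ[F] (A → F) := (LinearMap.funLeft F F (Subtype.val : A → ι)).comp C.subtype
    have hker : LinearMap.ker φ ≠ ⊥ := by
      refine LinearMap.ker_ne_bot_of_finrank_lt ?_
      rw [Module.finrank_fintype_fun_eq_card, Fintype.card_coe, hA, hdim]
      omega
    obtain ⟨x, hx, hx0⟩ := Submodule.exists_mem_ne_zero_of_ne_bot hker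
    have hx0' : (x : ι → F) ≠ 0 := fun h => hx0 (Subtype.ext h)
    refine ⟨x, x.2, 0, C.zero_mem, hx0', ?_⟩
    have h1 := hdist x 0
    rw [sub_zero] at h1
    have h2 := hlt x x.2 hx0'
    have h3 : A ⊆ Finset.univ.filter fun i => (x : ι → F) i = 0 := fun i hi => by
      rw [Finset.mem_filter]
      exact ⟨Finset.mem_univ i, congrFun (LinearMap.mem_ker.1 hx) ⟨i, hi⟩⟩
    have h4 := Finset.card_le_card h3
    omega
  · rintro m ⟨x, hx, y, hy, hxy, rfl⟩
    have h1 := hdist x y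
    have h2 := hlt (x - y) (C.sub_mem hx hy) (sub_ne_zero.2 hxy)
    omega

end MDS

/-! ### Riemann-Roch spaces and evaluation codes -/

section RiemannRoch

variable {F : Type*} [Field F] {W : WeierstrassCurve F}

theorem divisorOf_nonneg (T : Multiset W.toAffine.Point) : 0 ≤ divisorOf T := by
  induction T using Multiset.induction_on with
  | empty => rw [divisorOf_zero]
  | cons P T ih =>
    rw [divisorOf_cons]
    exact add_nonneg (Finsupp.single_nonneg.2 zero_le_one) ih

theorem divisorOf_apply_pointPlace {T : Multiset W.toAffine.Point} {P : W.toAffine.Point}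
    (hP : P ∉ T) : divisorOf T (pointPlace W P) = 0 :=
  divisorOf_apply_of_notMem fun _ hQ h => hP (pointPlace_injective h ▸ hQ)

variable [W.IsElliptic]

theorem riemannRochSpace_mono {G G' : Place F W.toAffine.FunctionField →₀ ℤ} (h : G ≤ G') :
    riemannRochSpace G ≤ riemannRochSpace G' := by
  intro f hf
  rw [mem_riemannRochSpace] at hf ⊢
  exact fun v => (hf v).trans ((isUniformizer_unif v).zpow_le_iff.2 (neg_le_neg (h v)))

theorem algebraMap_mem_riemannRochSpace (T : Multiset W.toAffine.Point) (c : F) :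
    algebraMap F _ c ∈ riemannRochSpace (divisorOf T) := by
  rw [mem_riemannRochSpace]
  intro v
  refine (v.val_algebraMap_le_one c).trans ?_
  rw [← zpow_zero (v.val (unif v)), (isUniformizer_unif v).zpow_le_iff]
  exact neg_nonpos.2 (divisorOf_nonneg T v)

theorem riemannRochSpace_le_cons (P : W.toAffine.Point) (T : Multiset W.toAffine.Point) :
    riemannRochSpace (divisorOf T) ≤ riemannRochSpace (divisorOf (P ::ₘ T)) := by
  refine riemannRochSpace_mono ?_
  rw [divisorOf_cons]
  exact le_add_of_nonneg_left (Finsupp.single_nonneg.2 zero_le_one)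

theorem val_le_one_of_notMem {T : Multiset W.toAffine.Point} {P : W.toAffine.Point} (hP : P ∉ T)
    {f : W.toAffine.FunctionField} (hf : f ∈ riemannRochSpace (divisorOf T)) :
    (pointPlace W P).val f ≤ 1 := by
  have h := mem_riemannRochSpace.1 hf (pointPlace W P)
  rwa [divisorOf_apply_pointPlace hP, neg_zero, zpow_zero] at h

theorem hasValue_value {T : Multiset W.toAffine.Point} {P : W.toAffine.Point} (hP : P ∉ T)
    {f : W.toAffine.FunctionField} (hf : f ∈ riemannRochSpace (divisorOf T)) :
    (pointPlace W P).HasValue f ((pointPlace W P).value f) := by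
  obtain ⟨c, hc⟩ := exists_hasValue (val_le_one_of_notMem hP hf)
  rwa [hc.value_eq]

/-- A function of `L(T)` that is not in the smaller space has a pole at the additional point of the
largest order possible. -/
theorem val_eq_of_notMem {T : Multiset W.toAffine.Point} {P : W.toAffine.Point}
    {f : W.toAffine.FunctionField} (hf : f ∈ riemannRochSpace (divisorOf (P ::ₘ T)))
    (hf' : f ∉ riemannRochSpace (divisorOf T)) :
    (pointPlace W P).val f = (pointPlace W P).val (unif (pointPlace W P)) ^
      (-(divisorOf T (pointPlace W P) + 1)) := by
  have hf0 : f ≠ 0 := by rintro rfl; exact hf' (Submodule.zero_mem _)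
  rw [mem_riemannRochSpace] at hf hf'
  push Not at hf'
  obtain ⟨v, hv⟩ := hf'
  have hvP : v = pointPlace W P := by
    by_contra h
    have h1 := hf v
    rw [divisorOf_cons, Finsupp.add_apply, Finsupp.single_eq_of_ne h, zero_add] at h1
    exact absurd h1 (not_le.2 hv)
  subst hvP
  have h1 := hf (pointPlace W P)
  rw [divisorOf_cons, Finsupp.add_apply, Finsupp.single_eq_same] at h1
  obtain ⟨n, hn⟩ := exists_val_eq_zpow (pointPlace W P) hf0
  rw [hn, (isUniformizer_unif _).zpow_le_iff] at h1
  rw [hn, (isUniformizer_unif _).zpow_lt_iff] at hv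
  rw [hn]
  congr 1
  omega

/-- Adding a rational point to a divisor enlarges the Riemann-Roch space at most by one
dimension, because the residue field is `F`. -/
theorem exists_riemannRochSpace_cons_le (P : W.toAffine.Point) (T : Multiset W.toAffine.Point) :
    ∃ f₀, riemannRochSpace (divisorOf (P ::ₘ T)) ≤
      Submodule.span F {f₀} ⊔ riemannRochSpace (divisorOf T) := by
  by_cases h : riemannRochSpace (divisorOf (P ::ₘ T)) ≤ riemannRochSpace (divisorOf T)
  · exact ⟨0, h.trans le_sup_right⟩
  obtain ⟨f₀, hf₀, hf₀'⟩ := SetLike.not_le_iff_exists.1 h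
  have hval := val_eq_of_notMem hf₀ hf₀'
  refine ⟨f₀, fun f hf => ?_⟩
  have h0 : f₀ ≠ 0 := by rintro rfl; exact hf₀' (Submodule.zero_mem _)
  have hpos : 0 < (pointPlace W P).val f₀ := (Valuation.pos_iff _).2 h0
  have hle : (pointPlace W P).val (f / f₀) ≤ 1 := by
    rw [map_div₀, div_le_one₀ hpos, hval]
    have h1 := mem_riemannRochSpace.1 hf (pointPlace W P)
    rwa [divisorOf_cons, Finsupp.add_apply, Finsupp.single_eq_same, add_comm] at h1
  obtain ⟨c, hc⟩ := exists_hasValue hle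
  have hsub : f - c • f₀ ∈ riemannRochSpace (divisorOf T) := by
    by_contra hn
    have h1 := val_eq_of_notMem (Submodule.sub_mem _ hf (Submodule.smul_mem _ c hf₀)) hn
    rw [← hval] at h1
    have h2 : f - c • f₀ = (f / f₀ - algebraMap F _ c) * f₀ := by
      rw [sub_mul, div_mul_cancel₀ _ h0, Algebra.smul_def]
    rw [h2, map_mul] at h1
    have h3 := mul_lt_mul_of_pos_right hc hpos
    rw [h1, one_mul] at h3
    exact lt_irrefl _ h3
  rw [← add_sub_cancel (c • f₀) f]
  exact Submodule.add_mem_sup (Submodule.smul_mem _ _ (Submodule.mem_span_singleton_self _)) hsub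

theorem finiteDimensional_cons (P : W.toAffine.Point) {T : Multiset W.toAffine.Point}
    (h : FiniteDimensional F (riemannRochSpace (divisorOf T))) :
    FiniteDimensional F (riemannRochSpace (divisorOf (P ::ₘ T))) := by
  obtain ⟨f₀, hf₀⟩ := exists_riemannRochSpace_cons_le P T
  exact Submodule.finiteDimensional_of_le hf₀

theorem finrank_cons_le (P : W.toAffine.Point) {T : Multiset W.toAffine.Point}
    (h : FiniteDimensional F (riemannRochSpace (divisorOf T))) :
    Module.finrank F (riemannRochSpace (divisorOf (P ::ₘ T))) ≤
      Module.finrank F (riemannRochSpace (divisorOf T)) + 1 := by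
  obtain ⟨f₀, hf₀⟩ := exists_riemannRochSpace_cons_le P T
  have h1 := Submodule.finrank_mono hf₀
  have h2 := Submodule.finrank_add_le_finrank_add_finrank (Submodule.span F {f₀})
    (riemannRochSpace (divisorOf T))
  have h3 := finrank_span_le_card (R := F) ({f₀} : Set W.toAffine.FunctionField)
  rw [Set.toFinset_singleton, Finset.card_singleton] at h3
  omega

/-- Evaluation of the functions of `L(T)` at points outside `T`. -/
noncomputable def evalMap {ι : Type*} (T : Multiset W.toAffine.Point) (D : ι → W.toAffine.Point)
    (hD : ∀ i, D i ∉ T) : riemannRochSpace (divisorOf T) →ₗ[F] (ι → F) where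
  toFun f i := (pointPlace W (D i)).value (f : W.toAffine.FunctionField)
  map_add' f g := funext fun i =>
    ((hasValue_value (hD i) f.2).add (hasValue_value (hD i) g.2)).value_eq
  map_smul' c f := funext fun i => ((hasValue_value (hD i) f.2).smul c).value_eq

theorem agCode_eq_range {ι : Type*} (T : Multiset W.toAffine.Point) (D : ι → W.toAffine.Point)
    (hD : ∀ i, D i ∉ T) :
    agCode (fun i => pointPlace W (D i)) (divisorOf T) = LinearMap.range (evalMap T D hD) := by
  ext c
  constructor
  · rintro ⟨f, hf, hc⟩
    exact ⟨⟨f, hf⟩, funext fun i => (hc i).value_eq⟩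
  · rintro ⟨f, rfl⟩
    exact ⟨f, f.2, fun i => hasValue_value (hD i) f.2⟩

variable [DecidableEq F]

theorem card_le_finrank {T : Multiset W.toAffine.Point}
    (h : FiniteDimensional F (riemannRochSpace (divisorOf T))) :
    Multiset.card T ≤ Module.finrank F (riemannRochSpace (divisorOf T)) := by
  obtain ⟨f, hf, hmem⟩ := exists_linearIndependent T
  have h1 : LinearIndependent F fun j => (⟨f j, hmem j⟩ : riemannRochSpace (divisorOf T)) :=
    LinearIndependent.of_comp (riemannRochSpace (divisorOf T)).subtype hf
  simpa using h1.fintype_card_le_finrank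

/-- A function of `L(T)` vanishing at as many distinct points outside `T` as `T` has points is zero,
unless these points have the same sum as those of `T`. -/
theorem eq_zero_of_hasValue_zero {T : Multiset W.toAffine.Point} {S : Finset W.toAffine.Point}
    (hcard : S.card = Multiset.card T) (hdisj : ∀ P ∈ S, P ∉ T) (hsum : ∑ P ∈ S, P ≠ T.sum)
    {f : W.toAffine.FunctionField} (hf : f ∈ riemannRochSpace (divisorOf T))
    (hS : ∀ P ∈ S, (pointPlace W P).HasValue f 0) : f = 0 := by
  by_contra hf0
  refine hsum ?_
  have h := sum_eq_of_val_le (S := S.val) (T := T) hcard hf0 fun v => ?_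
  · rw [← h, Finset.sum, Multiset.map_id']
  by_cases hv : ∃ P ∈ S, v = pointPlace W P
  · obtain ⟨P, hP, rfl⟩ := hv
    rw [divisorOf_apply_of_nodup S.nodup hP, divisorOf_apply_pointPlace (hdisj P hP), sub_zero,
      zpow_one]
    exact (isUniformizer_unif _).2 _ (hasValue_zero_iff.1 (hS P hP))
  · push Not at hv
    rw [divisorOf_apply_of_notMem (S := S.val) hv, zero_sub]
    exact mem_riemannRochSpace.1 hf v

theorem evalMap_injective {T : Multiset W.toAffine.Point} {S : Finset W.toAffine.Point}
    (hcard : S.card = Multiset.card T) (hdisj : ∀ P ∈ S, P ∉ T) (hsum : ∑ P ∈ S, P ≠ T.sum) :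
    Function.Injective (evalMap T (fun P : S => (P : W.toAffine.Point)) fun P => hdisj P P.2) := by
  rw [injective_iff_map_eq_zero]
  intro f hf
  refine Subtype.ext (eq_zero_of_hasValue_zero hcard hdisj hsum f.2 fun P hP => ?_)
  have h : (pointPlace W P).value (f : W.toAffine.FunctionField) = 0 := congrFun hf ⟨P, hP⟩
  exact h ▸ hasValue_value (hdisj P hP) f.2

/-- `dim L(T) = deg T` if `deg T` points outside `T` have a sum different from that of `T`: then
evaluation at these points is injective on `L(T)`. -/
theorem finrank_eq_card {T : Multiset W.toAffine.Point} {S : Finset W.toAffine.Point}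
    (hcard : S.card = Multiset.card T) (hdisj : ∀ P ∈ S, P ∉ T) (hsum : ∑ P ∈ S, P ≠ T.sum) :
    FiniteDimensional F (riemannRochSpace (divisorOf T)) ∧
      Module.finrank F (riemannRochSpace (divisorOf T)) = Multiset.card T := by
  have hinj := evalMap_injective hcard hdisj hsum
  have hfin := FiniteDimensional.of_injective _ hinj
  refine ⟨hfin, le_antisymm ?_ (card_le_finrank hfin)⟩
  have h := LinearMap.finrank_le_finrank_of_injective hinj
  rwa [Module.finrank_fintype_fun_eq_card, Fintype.card_coe, hcard] at h

/-- If no `deg T` of the points `D i`, which avoid `T`, have the same sum as `T`, then evaluation of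
`L(T)` at these points gives an MDS code. -/
theorem hasParameters_agCode {ι : Type*} [Finite ι] {T : Multiset W.toAffine.Point}
    {D : ι → W.toAffine.Point} (hinj : Function.Injective D) (hD : ∀ i, D i ∉ T)
    (hsum : ∀ Z : Finset ι, Z.card = Multiset.card T → ∑ i ∈ Z, D i ≠ T.sum) {n k : ℕ}
    (hn : Nat.card ι = n) (hT : Multiset.card T = k) (hk : 1 ≤ k) (hkn : k ≤ n) :
    HasParameters (agCode (fun i => pointPlace W (D i)) (divisorOf T)) n k (n - k + 1) := by
  have hzero : ∀ f : riemannRochSpace (divisorOf T), ∀ Z : Finset ι, Z.card = k →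
      (∀ i ∈ Z, evalMap T D hD f i = 0) → f = 0 := fun f Z hZ h => by
    refine Subtype.ext (eq_zero_of_hasValue_zero (S := Z.map ⟨D, hinj⟩)
      (by rw [Finset.card_map, hZ, hT])
      (fun P hP => ?_) ?_ f.2 fun P hP => ?_)
    · obtain ⟨i, -, rfl⟩ := Finset.mem_map.1 hP
      exact hD i
    · rw [Finset.sum_map]
      exact hsum Z (hZ.trans hT.symm)
    · obtain ⟨i, hi, rfl⟩ := Finset.mem_map.1 hP
      have h1 : (pointPlace W (D i)).value (f : W.toAffine.FunctionField) = 0 := h i hi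
      exact h1 ▸ hasValue_value (hD i) f.2
  let _ : Fintype ι := Fintype.ofFinite ι
  obtain ⟨Z, -, hZ⟩ := Finset.exists_subset_card_eq (s := (Finset.univ : Finset ι)) (n := k)
    (by rwa [Finset.card_univ, ← Nat.card_eq_fintype_card, hn])
  have hker : Function.Injective (evalMap T D hD) := by
    rw [injective_iff_map_eq_zero]
    exact fun f hf => hzero f Z hZ fun i _ => congrFun hf i
  rw [agCode_eq_range T D hD]
  refine hasParameters_of_eq_zero hn hk hkn ?_ ?_
  · rw [LinearMap.finrank_range_of_inj hker,
      (finrank_eq_card (S := Z.map ⟨D, hinj⟩) ?_ ?_ ?_).2, hT]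
    · rw [Finset.card_map, hZ, hT]
    · intro P hP
      obtain ⟨i, -, rfl⟩ := Finset.mem_map.1 hP
      exact hD i
    · rw [Finset.sum_map]
      exact hsum Z (hZ.trans hT.symm)
  · rintro _ ⟨f, rfl⟩ Z hZ h
    rw [hzero f Z hZ h, map_zero]

end RiemannRoch

/-! ### Subgroups of index two -/

section IndexTwo

/-- A finite abelian group of even order has a subgroup of index two: multiplication by `2` is not
surjective, so that the quotient by its image is a nonzero vector space over `𝔽₂`, which has a
nonzero linear form. -/
theorem exists_index_eq_two {A : Type*} [AddCommGroup A] [Finite A] (h : Even (Nat.card A)) :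
    ∃ H : AddSubgroup A, H.index = 2 := by
  let φ : A →+ A := nsmulAddMonoidHom 2
  have hφ : φ.range ≠ ⊤ := by
    intro htop
    have hsurj : Function.Surjective φ := AddMonoidHom.range_eq_top.1 htop
    have hinj : Function.Injective φ := Finite.injective_iff_surjective.2 hsurj
    have : Fact (Nat.Prime 2) := ⟨Nat.prime_two⟩
    obtain ⟨x, hx⟩ := exists_prime_addOrderOf_dvd_card' (G := A) 2 h.two_dvd
    have hx0 : x = 0 := hinj (by
      rw [map_zero]
      change 2 • x = 0
      rw [← hx, addOrderOf_nsmul_eq_zero])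
    rw [hx0, addOrderOf_zero] at hx
    norm_num at hx
  let V := A ⧸ φ.range
  let _ : Module (ZMod 2) V := AddCommGroup.zmodModule fun v => by
    obtain ⟨a, rfl⟩ := QuotientAddGroup.mk_surjective v
    rw [← QuotientAddGroup.mk_nsmul, QuotientAddGroup.eq_zero_iff]
    exact ⟨a, rfl⟩
  obtain ⟨a, ha⟩ : ∃ a, a ∉ φ.range := by
    by_contra! h'
    exact hφ (eq_top_iff.2 fun a _ => h' a)
  have hv : (QuotientAddGroup.mk a : V) ≠ 0 := by
    rwa [ne_eq, QuotientAddGroup.eq_zero_iff]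
  obtain ⟨f, hf⟩ := Module.Projective.exists_dual_ne_zero (ZMod 2) hv
  let ψ : A →+ ZMod 2 := f.toAddMonoidHom.comp (QuotientAddGroup.mk' φ.range)
  have hψ : Function.Surjective ψ := by
    have h2 : ∀ z : ZMod 2, z ≠ 0 → z = 1 := by decide
    intro z
    by_cases hz : z = 0
    · exact ⟨0, by rw [map_zero, hz]⟩
    · exact ⟨a, by rw [h2 z hz]; exact h2 _ hf⟩
  refine ⟨ψ.ker, ?_⟩
  rw [AddSubgroup.index_ker, AddMonoidHom.range_eq_top.2 hψ]
  simp

variable {A : Type*} [AddCommGroup A] {H : AddSubgroup A}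

theorem nsmul_mem_iff_even (hH : H.index = 2) {a : A} (ha : a ∉ H) (m : ℕ) :
    m • a ∈ H ↔ Even m := by
  induction m with
  | zero => simp [H.zero_mem]
  | succ m ih =>
    rw [succ_nsmul, AddSubgroup.add_mem_iff_of_index_two hH, ih, Nat.even_add_one]
    tauto

theorem exists_notMem_of_index_eq_two (hH : H.index = 2) : ∃ a, a ∉ H := by
  by_contra! h
  have : H = ⊤ := eq_top_iff.2 fun a _ => h a
  rw [this, AddSubgroup.index_top] at hH
  norm_num at hH

theorem exists_finset_subset (H : AddSubgroup A) [Finite H] {m : ℕ} (hm : m ≤ Nat.card H) :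
    ∃ S : Finset A, S.card = m ∧ ∀ a ∈ S, a ∈ H := by
  let _ : Fintype H := Fintype.ofFinite H
  obtain ⟨S, -, hS⟩ := Finset.exists_subset_card_eq (s := (Finset.univ : Finset H)) (n := m)
    (by rwa [Finset.card_univ, ← Nat.card_eq_fintype_card])
  refine ⟨S.map ⟨Subtype.val, Subtype.val_injective⟩, by rw [Finset.card_map, hS], fun a ha => ?_⟩
  obtain ⟨b, -, rfl⟩ := Finset.mem_map.1 ha
  exact b.2

end IndexTwo

/-! ### Dimensions and functions with prescribed poles -/

section Dimension

variable {F : Type*} [Field F] {W : WeierstrassCurve F}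

theorem notMem_replicate {P Q : W.toAffine.Point} (h : P ≠ Q) (m : ℕ) :
    P ∉ Multiset.replicate m Q := fun hP => h (Multiset.eq_of_mem_replicate hP)

theorem divisorOf_replicate_self (m : ℕ) (Q : W.toAffine.Point) :
    divisorOf (Multiset.replicate m Q) (pointPlace W Q) = m := by
  rw [divisorOf_replicate, Finsupp.single_eq_same]

theorem twoPointDivisor_eq {k : ℕ} (hk : 1 ≤ k) (P Q : W.toAffine.Point) :
    twoPointDivisor W P Q k = divisorOf (P ::ₘ Multiset.replicate (k - 1) Q) := by
  rw [divisorOf_cons, divisorOf_replicate, twoPointDivisor, Nat.cast_sub hk, Nat.cast_one]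

variable [DecidableEq F] {H : AddSubgroup W.toAffine.Point}

theorem sum_replicate_notMem (hH : H.index = 2) {Q : W.toAffine.Point} (hQ : Q ∉ H) {m : ℕ}
    (hm : Odd m) : (Multiset.replicate m Q).sum ∉ H := by
  rw [Multiset.sum_replicate, nsmul_mem_iff_even hH hQ]
  exact Nat.not_even_iff_odd.2 hm

theorem sum_cons_replicate_notMem (hH : H.index = 2) {P Q : W.toAffine.Point} (hP : P ∈ H)
    (hQ : Q ∉ H) {k : ℕ} (hk : Even k) (hk2 : 2 ≤ k) :
    (P ::ₘ Multiset.replicate (k - 1) Q).sum ∉ H := by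
  rw [Multiset.sum_cons, H.add_mem_cancel_left hP]
  exact sum_replicate_notMem hH hQ (Nat.Even.sub_odd (by omega) hk odd_one)

variable [Finite F] [W.IsElliptic]

/-- `dim L(m Q) = m`. If `m` is odd, then a function of `L(m Q)` is determined by its values at `m`
points of `H`, by parity; if `m` is even, then `L(m Q)` is at most one dimension larger than
`L((m - 1) Q)`. -/
theorem finrank_replicate (hH : H.index = 2) {Q : W.toAffine.Point} (hQ : Q ∉ H) {m : ℕ}
    (hm : 1 ≤ m) (hmH : m ≤ Nat.card H) :
    FiniteDimensional F (riemannRochSpace (divisorOf (Multiset.replicate m Q))) ∧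
      Module.finrank F (riemannRochSpace (divisorOf (Multiset.replicate m Q))) = m := by
  have hodd : ∀ m, m ≤ Nat.card H → Odd m →
      FiniteDimensional F (riemannRochSpace (divisorOf (Multiset.replicate m Q))) ∧
      Module.finrank F (riemannRochSpace (divisorOf (Multiset.replicate m Q))) = m := by
    intro m hmH hm
    obtain ⟨S, hS, hSH⟩ := exists_finset_subset H hmH
    have h := finrank_eq_card (T := Multiset.replicate m Q) (S := S)
      (by rw [hS, Multiset.card_replicate])
      (fun P hP => notMem_replicate (fun h : P = Q => hQ (h ▸ hSH P hP)) m)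
      (fun h => sum_replicate_notMem hH hQ hm (h ▸ H.sum_mem hSH))
    rwa [Multiset.card_replicate] at h
  rcases Nat.even_or_odd m with he | ho
  · obtain ⟨m, rfl⟩ := Nat.exists_eq_add_of_le' hm
    have ho : Odd m := by rwa [Nat.even_add_one, Nat.not_even_iff_odd] at he
    obtain ⟨h1, h2⟩ := hodd m (by omega) ho
    rw [Multiset.replicate_succ]
    have h3 := finiteDimensional_cons Q h1
    refine ⟨h3, le_antisymm ((finrank_cons_le Q h1).trans (by rw [h2])) ?_⟩
    have h4 := card_le_finrank h3
    rwa [Multiset.card_cons, Multiset.card_replicate] at h4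
  · exact hodd m hmH ho

/-- `dim L(P + m Q) = m + 1`: the dimension is at most one larger than that of `L(m Q)`, and it is
at least the degree. -/
theorem finrank_cons_replicate (hH : H.index = 2) {Q : W.toAffine.Point} (hQ : Q ∉ H)
    (P : W.toAffine.Point) {m : ℕ} (hm : 1 ≤ m) (hmH : m ≤ Nat.card H) :
    FiniteDimensional F (riemannRochSpace (divisorOf (P ::ₘ Multiset.replicate m Q))) ∧
      Module.finrank F (riemannRochSpace (divisorOf (P ::ₘ Multiset.replicate m Q))) = m + 1 := by
  obtain ⟨h1, h2⟩ := finrank_replicate hH hQ hm hmH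
  have h3 := finiteDimensional_cons P h1
  refine ⟨h3, le_antisymm ((finrank_cons_le P h1).trans (by rw [h2])) ?_⟩
  have h4 := card_le_finrank h3
  rwa [Multiset.card_cons, Multiset.card_replicate] at h4

/-- For `i ≥ 2` there is a function with a pole of order `i` at `Q`, no other pole, and no zero at
`P`: add a constant to a function in `L(i Q)` outside `L((i - 1) Q)`. -/
theorem exists_hasOrd_neg (hH : H.index = 2) {Q : W.toAffine.Point} (hQ : Q ∉ H)
    {P : W.toAffine.Point} (hP : P ∈ H) {i : ℕ} (hi : 2 ≤ i) (hiH : i ≤ Nat.card H) :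
    ∃ f ∈ riemannRochSpace (divisorOf (Multiset.replicate i Q)),
      (pointPlace W Q).HasOrd f (-(i : ℤ)) ∧ (pointPlace W P).HasOrd f 0 := by
  have hPQ : P ≠ Q := fun h => hQ (h ▸ hP)
  obtain ⟨i, rfl⟩ := Nat.exists_eq_add_of_le' (show 1 ≤ i by omega)
  obtain ⟨hfin, hdim⟩ := finrank_replicate hH hQ (m := i) (by omega) (by omega)
  obtain ⟨-, hdim'⟩ := finrank_replicate hH hQ (m := i + 1) (by omega) hiH
  have hnle : ¬ riemannRochSpace (divisorOf (Multiset.replicate (i + 1) Q)) ≤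
      riemannRochSpace (divisorOf (Multiset.replicate i Q)) := fun h => by
    have := Submodule.finrank_mono h
    omega
  obtain ⟨h, hh, hh'⟩ := SetLike.not_le_iff_exists.1 hnle
  have hval : (pointPlace W Q).val h = (pointPlace W Q).val (unif (pointPlace W Q)) ^
      (-((i + 1 : ℕ) : ℤ)) := by
    rw [Multiset.replicate_succ] at hh
    rw [val_eq_of_notMem hh hh', divisorOf_replicate_self]
    push_cast
    rfl
  set c := (pointPlace W P).value h
  have hc := hasValue_value (notMem_replicate hPQ (i + 1)) hh
  refine ⟨h + algebraMap F _ (1 - c),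
    Submodule.add_mem _ hh (algebraMap_mem_riemannRochSpace _ _), ?_, ?_⟩
  · rw [hasOrd_iff, ← hval]
    refine Valuation.map_add_eq_of_lt_left _
      (((pointPlace W Q).val_algebraMap_le_one _).trans_lt ?_)
    rw [hval, ← zpow_zero ((pointPlace W Q).val (unif (pointPlace W Q))),
      (isUniformizer_unif _).zpow_lt_iff]
    push_cast
    omega
  · rw [hasOrd_iff, zpow_zero]
    have h1 : (pointPlace W P).HasValue (h + algebraMap F _ (1 - c)) 1 := by
      have := hc.add (hasValue_algebraMap (v := pointPlace W P) (1 - c))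
      rwa [add_sub_cancel] at this
    exact h1.val_eq_one one_ne_zero

/-- There is a function whose only poles are simple poles at `P` and `Q`. -/
theorem exists_hasOrd_neg_one (hH : H.index = 2) {Q : W.toAffine.Point} (hQ : Q ∉ H)
    {P : W.toAffine.Point} (hP : P ∈ H) (hcard : 1 ≤ Nat.card H) :
    ∃ g ∈ riemannRochSpace (divisorOf (P ::ₘ Multiset.replicate 1 Q)),
      (pointPlace W P).HasOrd g (-1) ∧ (pointPlace W Q).HasOrd g (-1) := by
  have hPQ : P ≠ Q := fun h => hQ (h ▸ hP)
  obtain ⟨hfin, hdim⟩ := finrank_replicate hH hQ le_rfl hcard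
  obtain ⟨-, hdim'⟩ := finrank_cons_replicate hH hQ P le_rfl hcard
  have hnle : ¬ riemannRochSpace (divisorOf (P ::ₘ Multiset.replicate 1 Q)) ≤
      riemannRochSpace (divisorOf (Multiset.replicate 1 Q)) := fun h => by
    have := Submodule.finrank_mono h
    omega
  obtain ⟨g, hg, hg'⟩ := SetLike.not_le_iff_exists.1 hnle
  refine ⟨g, hg, ?_, ?_⟩
  · rw [hasOrd_iff, val_eq_of_notMem hg hg', divisorOf_apply_pointPlace (notMem_replicate hPQ 1)]
    rfl
  · have hswap : P ::ₘ Multiset.replicate 1 Q = Q ::ₘ Multiset.replicate 1 P :=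
      Multiset.cons_swap P Q 0
    rw [hswap] at hg
    have hg'' : g ∉ riemannRochSpace (divisorOf (Multiset.replicate 1 P)) := fun h => by
      -- the constant `g - g(Q)` would vanish
      have hv := hasValue_value (notMem_replicate hPQ.symm 1) h
      have h0 := eq_zero_of_hasValue_zero (S := {Q}) (T := Multiset.replicate 1 P)
        (f := g - algebraMap F _ ((pointPlace W Q).value g)) (by simp)
        (by simpa using hPQ.symm) (by simpa using hPQ.symm)
        (Submodule.sub_mem _ h (algebraMap_mem_riemannRochSpace _ _)) (fun R hR => by
          rw [Finset.mem_singleton.1 hR, hasValue_zero_iff]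
          exact hv)
      rw [sub_eq_zero] at h0
      exact hg' (h0 ▸ algebraMap_mem_riemannRochSpace _ _)
    rw [hasOrd_iff, val_eq_of_notMem hg hg'',
      divisorOf_apply_pointPlace (notMem_replicate hPQ.symm 1)]
    rfl

end Dimension

/-! ### Pole systems and the extended code -/

section ExtendedCode

variable {F : Type*} [Field F] {W : WeierstrassCurve F} [W.IsElliptic]

/-- A function of `L(P + T)` without a zero or a pole at `P ∉ T` belongs to `L(T)`. -/
theorem mem_riemannRochSpace_of_hasOrd_zero {T : Multiset W.toAffine.Point} {P : W.toAffine.Point}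
    (hP : P ∉ T) {f : W.toAffine.FunctionField}
    (hf : f ∈ riemannRochSpace (divisorOf (P ::ₘ T))) (h0 : (pointPlace W P).HasOrd f 0) :
    f ∈ riemannRochSpace (divisorOf T) := by
  by_contra h
  have h1 := val_eq_of_notMem hf h
  rw [hasOrd_iff.1 h0, divisorOf_apply_pointPlace hP] at h1
  have h2 := (isUniformizer_unif (pointPlace W P)).zpow_le_iff.1 h1.le
  have h3 := (isUniformizer_unif (pointPlace W P)).zpow_le_iff.1 h1.ge
  omega

section PoleSystem

variable {P Q : W.toAffine.Point} {k : ℕ} {f : ℕ → W.toAffine.FunctionField}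
  {g : W.toAffine.FunctionField}

theorem poleList_mem (hk : 2 ≤ k) (h : IsPoleSystem W P Q k f g) (i : Fin k) :
    poleList k f g i ∈ riemannRochSpace (divisorOf (P ::ₘ Multiset.replicate (k - 1) Q)) := by
  have hT := twoPointDivisor_eq (show 1 ≤ k by omega) P Q
  unfold poleList
  split_ifs with h1 h2
  · rw [← map_one (algebraMap F W.toAffine.FunctionField)]
    exact algebraMap_mem_riemannRochSpace _ _
  · exact hT ▸ h.2.1
  · exact hT ▸ (h.1 (i + 1) (by omega) (by omega)).1

/-- All functions of a pole system but the last one are regular at `P`. -/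
theorem poleList_mem_replicate (hPQ : P ≠ Q) (hk : 2 ≤ k) (h : IsPoleSystem W P Q k f g)
    {i : Fin k} (hi : (i : ℕ) + 1 ≠ k) :
    poleList k f g i ∈ riemannRochSpace (divisorOf (Multiset.replicate (k - 1) Q)) := by
  refine mem_riemannRochSpace_of_hasOrd_zero (notMem_replicate hPQ _) (poleList_mem hk h i) ?_
  unfold poleList
  split_ifs with h1
  · rw [hasOrd_iff, map_one, zpow_zero]
  · exact (h.1 (i + 1) (by omega) (by omega)).2.2

/-- The functions of a pole system have distinct pole orders at `Q`. -/
theorem linearIndependent_poleList (h : IsPoleSystem W P Q k f g) :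
    LinearIndependent F (poleList k f g) := by
  have hval : ∀ i : Fin k, (pointPlace W Q).val (poleList k f g i) =
      (pointPlace W Q).val (unif (pointPlace W Q)) ^ (if (i : ℕ) = 0 then (0 : ℤ) else
        if (i : ℕ) + 1 = k then -1 else -((i : ℕ) + 1 : ℤ)) := fun i => by
    unfold poleList
    split_ifs with h1 h2
    · rw [map_one, zpow_zero]
    · exact hasOrd_iff.1 h.2.2.2
    · have h3 := hasOrd_iff.1 (h.1 (i + 1) (by omega) (by omega)).2.1
      rw [h3]
      push_cast
      rfl
  have hunif := isUniformizer_unif (pointPlace W Q)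
  refine linearIndependent_of_val_injective (pointPlace W Q) (fun i => ?_) fun i j hij => ?_
  · rw [← (pointPlace W Q).val.ne_zero_iff, hval]
    exact (zpow_pos hunif.val_pos _).ne'
  · simp only [hval] at hij
    have h2 := hunif.zpow_le_iff.1 hij.le
    have h3 := hunif.zpow_le_iff.1 hij.ge
    have := i.2
    have := j.2
    apply Fin.ext
    split_ifs at h2 h3 <;> omega

variable [DecidableEq F] [Finite F] {H : AddSubgroup W.toAffine.Point}

/-- The witnesses come from `exists_hasOrd_neg` for the indices `2 ≤ i < k`, the only ones on which
a pole system depends, and from `exists_hasOrd_neg_one`. -/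
theorem exists_isPoleSystem (hH : H.index = 2) (hP : P ∈ H) (hQ : Q ∉ H) (hk : 2 ≤ k)
    (hkH : k ≤ Nat.card H) : ∃ f g, IsPoleSystem W P Q k f g := by
  have hf : ∀ i, ∃ f : W.toAffine.FunctionField, 2 ≤ i → i < k →
      f ∈ riemannRochSpace (divisorOf (Multiset.replicate i Q)) ∧
        (pointPlace W Q).HasOrd f (-(i : ℤ)) ∧ (pointPlace W P).HasOrd f 0 := fun i => by
    by_cases hi : 2 ≤ i ∧ i < k
    · obtain ⟨f, h1, h2⟩ := exists_hasOrd_neg hH hQ hP hi.1 (by omega)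
      exact ⟨f, fun _ _ => ⟨h1, h2⟩⟩
    · exact ⟨0, fun h1 h2 => absurd ⟨h1, h2⟩ hi⟩
  choose f hf using hf
  obtain ⟨g, hg, hg'⟩ := exists_hasOrd_neg_one hH hQ hP (by omega)
  have hmono : ∀ i ≤ k - 1, divisorOf (Multiset.replicate i Q) ≤
      divisorOf (Multiset.replicate (k - 1) Q) := fun i hi => by
    rw [divisorOf_replicate, divisorOf_replicate]
    exact Finsupp.single_mono (by exact_mod_cast hi)
  refine ⟨f, g, fun i hi hik => ⟨?_, (hf i hi hik).2⟩, ?_, hg'⟩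
  · rw [twoPointDivisor_eq (by omega)]
    exact riemannRochSpace_le_cons P _ (riemannRochSpace_mono (hmono i (by omega)) (hf i hi hik).1)
  · rw [twoPointDivisor_eq (by omega)]
    refine riemannRochSpace_mono ?_ hg
    rw [divisorOf_cons, divisorOf_cons]
    exact add_le_add_right (hmono 1 (by omega)) _

/-- The functions of a pole system span `L(P + (k - 1) Q)`, because the dimensions agree. -/
theorem span_poleList (hH : H.index = 2) (hQ : Q ∉ H) (hk : 2 ≤ k)
    (hkH : k ≤ Nat.card H) (h : IsPoleSystem W P Q k f g) :
    Submodule.span F (Set.range (poleList k f g)) =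
      riemannRochSpace (divisorOf (P ::ₘ Multiset.replicate (k - 1) Q)) := by
  obtain ⟨hfin, hdim⟩ := finrank_cons_replicate hH hQ P (m := k - 1) (by omega) (by omega)
  refine Submodule.eq_of_le_of_finrank_eq ?_ ?_
  · rw [Submodule.span_le]
    rintro _ ⟨i, rfl⟩
    exact poleList_mem hk h i
  · rw [finrank_span_eq_card (linearIndependent_poleList h), hdim, Fintype.card_fin]
    omega

/-- The extended code is an MDS code: a word that vanishes at the appended coordinate comes from
`L((k - 1) Q)`, and such a function has at most `k - 2` zeros in `H`, again by parity. -/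
theorem hasParameters_extended (hH : H.index = 2) (hP : P ∈ H) (hQ : Q ∉ H) (hk : Even k)
    (hk2 : 2 ≤ k) {n : ℕ} (hn : Nat.card H = n) (hkn : k ≤ n) (h : IsPoleSystem W P Q k f g) :
    HasParameters (codeGeneratedBy (extendedMatrix
      (fun R : {R : W.toAffine.Point // R ∈ H ∧ R ≠ P} => pointPlace W R.1) (poleList k f g)))
      n k (n - k + 1) := by
  have hPQ : P ≠ Q := fun h => hQ (h ▸ hP)
  set T := P ::ₘ Multiset.replicate (k - 1) Q with hT
  let ι := {R : W.toAffine.Point // R ∈ H ∧ R ≠ P}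
  have hnotMem : ∀ R : ι, R.1 ∉ Multiset.replicate (k - 1) Q := fun R =>
    notMem_replicate (fun h : R.1 = Q => hQ (h ▸ R.2.1)) _
  have hD : ∀ R : ι, R.1 ∉ T := fun R => by
    rw [hT, Multiset.mem_cons, not_or]
    exact ⟨R.2.2, hnotMem R⟩
  have hcardι : Nat.card (Option ι) = n := by
    rw [Finite.card_option, ← hn]
    have h1 := Set.ncard_sdiff_singleton_add_one (s := (H : Set W.toAffine.Point)) hP
      (Set.toFinite _)
    exact h1
  set b := poleList k f g with hb
  set M := extendedMatrix (fun R : ι => pointPlace W R.1) b with hM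
  have hlin := linearIndependent_poleList h
  let last : Fin k := ⟨k - 1, by omega⟩
  have hlast : ∀ i : Fin k, (i : ℕ) + 1 = k ↔ i = last := fun i => by
    rw [Fin.ext_iff]
    change _ ↔ (i : ℕ) = k - 1
    omega
  -- the entries of a combination of the rows
  have hsome : ∀ (a : Fin k → F) (R : ι),
      (pointPlace W R.1).HasValue (∑ i, a i • b i) ((∑ i, a i • M i) (some R)) := fun a R => by
    have h1 : ∀ s : Finset (Fin k),
        (pointPlace W R.1).HasValue (∑ i ∈ s, a i • b i) (∑ i ∈ s, a i * M i (some R)) :=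
      fun s => by
      induction s using Finset.induction_on with
      | empty => simp [Place.HasValue]
      | insert i s hi ih =>
        rw [Finset.sum_insert hi, Finset.sum_insert hi]
        exact ((hasValue_value (hD R) (poleList_mem hk2 h i)).smul (a i)).add ih
    have h2 := h1 Finset.univ
    simpa only [Finset.sum_apply, Pi.smul_apply, smul_eq_mul] using h2
  have hnone : ∀ a : Fin k → F, (∑ i, a i • M i) none = a last := fun a => by
    have h1 : ∀ i, M i none = if i = last then 1 else 0 := fun i => by
      rw [hM, extendedMatrix]
      simp only [hlast]
    simp only [Finset.sum_apply, Pi.smul_apply, smul_eq_mul, h1, mul_ite, mul_one, mul_zero,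
      Finset.sum_ite_eq', Finset.mem_univ, if_true]
  have hzero : ∀ (a : Fin k → F) (Z : Finset (Option ι)), Z.card = k →
      (∀ o ∈ Z, (∑ i, a i • M i) o = 0) → a = 0 := fun a Z hZ ha => by
    have hmap : ∀ R ∈ (Finset.eraseNone Z).map ⟨Subtype.val, Subtype.val_injective⟩,
        R ∈ H ∧ R ∉ T ∧ R ∉ Multiset.replicate (k - 1) Q ∧
          (pointPlace W R).HasValue (∑ i, a i • b i) 0 := fun R hR => by
      obtain ⟨R, hRZ, rfl⟩ := Finset.mem_map.1 hR
      refine ⟨R.2.1, hD R, hnotMem R, ?_⟩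
      rw [← ha _ (Finset.mem_eraseNone.1 hRZ)]
      exact hsome a R
    have hf : ∑ i, a i • b i = 0 := by
      by_cases hnZ : none ∈ Z
      · have hal : a last = 0 := (hnone a).symm.trans (ha _ hnZ)
        refine eq_zero_of_hasValue_zero (T := Multiset.replicate (k - 1) Q)
          (S := (Finset.eraseNone Z).map ⟨Subtype.val, Subtype.val_injective⟩) ?_
          (fun R hR => (hmap R hR).2.2.1) (fun hs => ?_) (Submodule.sum_mem _ fun i _ => ?_)
          (fun R hR => (hmap R hR).2.2.2)
        · rw [Finset.card_map, Finset.card_eraseNone_of_mem hnZ, hZ, Multiset.card_replicate]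
        · exact sum_replicate_notMem hH hQ (Nat.Even.sub_odd (by omega) hk odd_one)
            (hs ▸ H.sum_mem fun R hR => (hmap R hR).1)
        · by_cases hi : i = last
          · rw [hi, hal, zero_smul]
            exact Submodule.zero_mem _
          · exact Submodule.smul_mem _ _
              (poleList_mem_replicate hPQ hk2 h fun h => hi ((hlast i).1 h))
      · refine eq_zero_of_hasValue_zero (T := T)
          (S := (Finset.eraseNone Z).map ⟨Subtype.val, Subtype.val_injective⟩) ?_
          (fun R hR => (hmap R hR).2.1) (fun hs => ?_)
          (Submodule.sum_mem _ fun i _ => Submodule.smul_mem _ _ (poleList_mem hk2 h i))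
          (fun R hR => (hmap R hR).2.2.2)
        · rw [Finset.card_map, Finset.card_eraseNone_of_not_mem hnZ, hZ, hT, Multiset.card_cons,
            Multiset.card_replicate]
          omega
        · exact sum_cons_replicate_notMem hH hP hQ hk hk2
            (hs ▸ H.sum_mem fun R hR => (hmap R hR).1)
    exact funext (Fintype.linearIndependent_iff.1 hlin a hf)
  have hrows : LinearIndependent F fun i => M i := by
    let _ : Fintype (Option ι) := Fintype.ofFinite _
    obtain ⟨Z, -, hZ⟩ := Finset.exists_subset_card_eq (s := (Finset.univ : Finset (Option ι)))
      (n := k) (by rwa [Finset.card_univ, ← Nat.card_eq_fintype_card, hcardι])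
    rw [Fintype.linearIndependent_iff]
    exact fun a ha => congrFun (hzero a Z hZ fun o _ => by rw [ha]; rfl)
  refine hasParameters_of_eq_zero hcardι (by omega) hkn ?_ fun c hc Z hZ hcZ => ?_
  · rw [codeGeneratedBy, finrank_span_eq_card hrows, Fintype.card_fin]
  · obtain ⟨a, rfl⟩ := (Submodule.mem_span_range_iff_exists_fun F).1 hc
    rw [hzero a Z hZ hcZ]
    simp

end PoleSystem

end ExtendedCode

end EllipticCode

open EllipticCode in
theorem corollary1 {F : Type*} [Field F] [Finite F] [DecidableEq F]
    (W : WeierstrassCurve F) [W.IsElliptic] (N : ℕ) (hN : Nat.card W.toAffine.Point = N)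
    (hNeven : Even N) :
    (∃ H : AddSubgroup W.toAffine.Point, H.index = 2) ∧
    ∀ H : AddSubgroup W.toAffine.Point, H.index = 2 →
      -- even dimensions: one coordinate is appended to a code of length `N / 2 - 1`
      (∀ P ∈ H, ∀ Q ∉ H, ∀ k : ℕ, Even k → 2 ≤ k → k ≤ N / 2 →
        (k < N / 2 →
          HasParameters
            (agCode (fun R : {R : W.toAffine.Point // R ∈ H ∧ R ≠ P} => pointPlace W R.1)
              (twoPointDivisor W P Q k))
            (N / 2 - 1) k (N / 2 - k)) ∧
        (∃ (f : ℕ → W.toAffine.FunctionField) (g : W.toAffine.FunctionField),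
          IsPoleSystem W P Q k f g) ∧
        ∀ (f : ℕ → W.toAffine.FunctionField) (g : W.toAffine.FunctionField),
          IsPoleSystem W P Q k f g →
            LinearIndependent F (poleList k f g) ∧
            Submodule.span F (Set.range (poleList k f g)) =
              riemannRochSpace (twoPointDivisor W P Q k) ∧
            HasParameters
              (codeGeneratedBy (extendedMatrix
                (fun R : {R : W.toAffine.Point // R ∈ H ∧ R ≠ P} => pointPlace W R.1)
                (poleList k f g)))
              (N / 2) k (N / 2 - k + 1)) ∧
      -- odd dimensions: the code `C_L(D, kQ)`, where `D` is the sum of all points of `H`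
      (∃ Q : W.toAffine.Point, Q ∉ H) ∧
      (∀ Q ∉ H, ∀ k : ℕ, Odd k → k ≤ N / 2 →
        HasParameters
          (agCode (fun R : {R : W.toAffine.Point // R ∈ H} => pointPlace W R.1)
            (Finsupp.single (pointPlace W Q) (k : ℤ)))
          (N / 2) k (N / 2 - k + 1)) := by
  refine ⟨exists_index_eq_two (hN ▸ hNeven), fun H hH => ?_⟩
  have hcard : Nat.card H = N / 2 := by
    have := H.card_mul_index
    rw [hH, hN] at this
    omega
  refine ⟨fun P hP Q hQ k hk hk2 hkN => ⟨fun hlt => ?_,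
    exists_isPoleSystem hH hP hQ hk2 (hcard ▸ hkN), fun f g h => ⟨linearIndependent_poleList h, ?_,
      hasParameters_extended hH hP hQ hk hk2 hcard hkN h⟩⟩,
    exists_notMem_of_index_eq_two hH, fun Q hQ k hk hkN => ?_⟩
  · have hι : Nat.card {R : W.toAffine.Point // R ∈ H ∧ R ≠ P} = N / 2 - 1 := by
      have h1 := Set.ncard_sdiff_singleton_of_mem (s := (H : Set W.toAffine.Point)) hP
      rw [← hcard]
      exact h1
    have h := hasParameters_agCode (T := P ::ₘ Multiset.replicate (k - 1) Q)
      (D := fun R : {R : W.toAffine.Point // R ∈ H ∧ R ≠ P} => R.1) Subtype.val_injective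
      (fun R => by
        rw [Multiset.mem_cons, not_or]
        exact ⟨R.2.2, notMem_replicate (fun h : R.1 = Q => hQ (h ▸ R.2.1)) _⟩)
      (fun Z _ hs => sum_cons_replicate_notMem hH hP hQ hk hk2
        (hs ▸ H.sum_mem fun R _ => R.2.1)) hι
      (by rw [Multiset.card_cons, Multiset.card_replicate]; omega : _ = k) (by omega) (by omega)
    rw [← twoPointDivisor_eq (by omega)] at h
    convert h using 1
    omega
  · rw [twoPointDivisor_eq (by omega)]
    exact span_poleList hH hQ hk2 (hcard ▸ hkN) h
  · rw [← divisorOf_replicate]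
    exact hasParameters_agCode (D := fun R : {R : W.toAffine.Point // R ∈ H} => R.1)
      Subtype.val_injective (fun R => notMem_replicate (fun h : R.1 = Q => hQ (h ▸ R.2)) _)
      (fun Z _ hs => sum_replicate_notMem hH hQ hk (hs ▸ H.sum_mem fun R _ => R.2)) hcard
      (Multiset.card_replicate _ _) hk.pos hkN
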